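/- **Setting.** Let $\mathbb F_q$ be a finite field, $k\ge 1$, and let $\mathcal A=(P,Q)$ be a polynomial system: $P,Q\subset\mathbb F_q[x_1,\dots,x_k]$ are finite sets (of equations $p=0$ and disequations $q\neq 0$). For a system $(P,Q)$ in $m$ variables put $$\mathrm{zero}_q(P,Q)=\{\xi\in\mathbb F_q^m : p(\xi)=0 \text{ for all } p\in P,\ q(\xi)\ne 0 \text{ for all } q\in Q\},$$ and let $\mathrm{proj}_k\,\mathrm{zero}_q(\mathcal A)$ be the set of $\xi\in\mathbb F_q^{k-1}$ such that $(\xi,\beta)\in \mathrm{zero}_q(\mathcal A)$ for some $\beta\in\mathbb F_q$. **Theorem.** Let $\alpha\in\mathbb F_q^{k-1}$ be such that there is no $\beta\in\mathbb F_q$ with $(\alpha,\beta)\in\mathrm{zero}_q(\mathcal A)$. Then, whatever selections are made, the algorithm $\mathsf P_{\mathsf{Reg}}(\mathcal A,\alpha)$ described below terminates (there is no infinite chain of recursive calls, and each call reaches a return statement), and every finite set $\Delta$ of systems over $\mathbb F_q[x_1,\dots,x_{k-1}]$ that it may return is a weak projecting zero decomposition of $\mathcal A$ for $\alpha$: $$\mathrm{proj}_k\,\mathrm{zero}_q(\mathcal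 A)\subseteq\bigcup_{(P',Q')\in\Delta}\mathrm{zero}_q(P',Q')\qquad\text{and}\qquad \alpha\notin\mathrm{zero}_q(P',Q')\ \text{ for all }(P',Q')\in\Delta .$$ **Notation.** Degree $\deg$, leading coefficient $\mathrm{lc}$ and reductum $\mathrm{red}(p)=p-\mathrm{lc}(p)x_k^{\deg p}$ are taken with respect to $x_k$. For a finite set $P$ of polynomials, $\hat P$ is the set of those $p\in P$ with $\deg p>0$; a polynomial is *free* if it lies in $\mathbb F_q[x_1,\dots,x_{k-1}]$. For $f\ne0$, the pseudo-quotient $\mathrm{pquo}(g,f)$ is the unique $o$ with $\mathrm{lc}(f)^d g=o f+r$, $\deg r<\deg f$ (meaning $r=0$ if $f$ is free), $d=\max(\deg g-\deg f+1,0)$. For $m=\deg f\ge l=\deg g>0$, the subresultant chain of $f,g$ is $S_{\mu+1}=f,\ S_\mu=g,\ S_{\mu-1},\dots,S_0$ with $\mu=m-1$ if $m>l$ and $\mu=l$ if $m=l$; for $j<\mu$, $S_j$ is the $j$-th subresultant $\sum_{i\le j}\det(M_{ij})\,x_k^i$ (minors of the Sylvester matrix) if $j<l$, $S_l=\mathrm{lc}(g)^{m-l-1}g$,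 and $S_j=0$ if $l<j<\mu$. The subresultant regular subchain $\mathrm{srs}(f,g)=h_2,\dots,h_r$ consists of the regular members ($\deg S_j=j$, $S_j\ne0$) of $S_\mu,\dots,S_0$, in this order. If $\deg f<\deg g$, $\mathrm{srs}(f,g)$ means $\mathrm{srs}(g,f)$. Write $l_i=\mathrm{lc}(h_i)$. For a polynomial $a$, $\mathrm{Proj_{Coeff}}(a,\alpha)$ is the set of systems $(\emptyset,\{c-c(\alpha)\})$, where $c$ runs over the nonzero coefficients of $a$ with respect to $x_k$. **Guards.** In "return $X$ if $c$", the guard $c$ is a constraint over $\mathbb F_q[x_1,\dots,x_{k-1}]$. If $c$ is true at $\alpha$, the result of the recursive call $X$ is returned, together with the one-constraint system given by $\neg c$. If $c$ is false at $\alpha$, the one-constraint system given by $c$ is added to what is finally returned, and execution continues. A call on $(P,Q)\cup\mathrm{Proj_{Coeff}}(a,\alpha)$ stands for the calls on $(P,Q\cup Q')$ for all $(\emptyset,Q')\in \mathrm{Proj_{Coeff}}(a,\alpha)$; the results are united. **Algorithm $\mathsf P_{\mathsf{Reg}}((P,Q),\alpha)$.** 1. Return $(\{p\},\emptyset)$ for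 any free $p\in P$ with $p(\alpha)\neq0$, if there is one. Otherwise return $(\emptyset,\{q\})$ for any free $q\in Q$ with $q(\alpha)=0$, if there is one. 2. Otherwise, if $\hat P\ne\emptyset$: select $p\in\hat P$ of smallest degree. - Return $\mathsf P_{\mathsf{Reg}}(P\setminus\{p\}\cup\{\mathrm{red}(p)\},Q,\alpha)$ if $\mathrm{lc}(p)=0$. - If $|\hat P|>1$: select any $p'\in\hat P\setminus\{p\}$ and let $h_2,\dots,h_r=\mathrm{srs}(p',p)$. If $h_r$ is free: return $\mathsf P_{\mathsf{Reg}}(P\setminus\{p,p'\}\cup\{h_r,h_{r-1}\},Q,\alpha)$ if $l_{r-1}\ne0$. Then for $i=s,s-1,\dots,2$, where $s=r-2$ if $h_r$ is free and $s=r$ otherwise: return $\mathsf P_{\mathsf{Reg}}(P\setminus\{p,p'\}\cup\{h_i,l_{i+1},\dots,l_r\},Q,\alpha)$ if $l_i\neq0$. - Else, if $\hat Q\neq\emptyset$: select any $q\in\hat Q$ and let $h_2,\dots,h_r=\mathrm{srs}(q,p)$. If $h_r$ is free: return $\mathsf P_{\mathsf{Reg}}(P\setminus\{p\}\cup\{\mathrm{pquo}(p,h_r)\},Q\setminus\{q\},\alpha)$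 if $l_r\ne0$. Then for $i=s,s-1,\dots,2$, where $s=r-1$ if $h_r$ is free and $s=r$ otherwise: return $\mathsf P_{\mathsf{Reg}}(P\setminus\{p\}\cup\{\mathrm{pquo}(p,h_i),l_{i+1},\dots,l_r\},Q,\alpha)$ if $l_i\neq0$. - Return $\mathsf P_{\mathsf{Reg}}((P,Q)\cup\mathrm{Proj_{Coeff}}(p,\alpha),\alpha)$. 3. Otherwise, if $\hat Q\ne\emptyset$: for all $q\in\hat Q$, in any order: return $\mathsf P_{\mathsf{Reg}}(P,Q\setminus\{q\}\cup\{\mathrm{red}(q)\},\alpha)$ if $\mathrm{lc}(q)=0$. Then return $\mathsf P_{\mathsf{Reg}}((P,Q\setminus\hat Q)\cup\mathrm{Proj_{Coeff}}(\prod_{q\in\hat Q}q,\alpha),\alpha)$. -/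

import Mathlib

open Polynomial

/-! ### Polynomial systems and their zeros -/

/-- A polynomial system `(P, Q)` over a ring `R`: the finite set `P` of polynomials of the equations
`p = 0` and the finite set `Q` of polynomials of the disequations `q ≠ 0`. -/
@[ext]
structure PolySystem (R : Type*) where
  eqs : Finset R
  neqs : Finset R

/-- `zero_q (P / Q)`: the points of `F ^ m` at which all polynomials of `P` vanish and
no polynomial of `Q` vanishes. -/
def zeroq {F : Type*} [Field F] {m : ℕ} (A : PolySystem (MvPolynomial (Fin m) F)) :
    Set (Fin m → F) :=
  {x | (∀ p ∈ A.eqs, MvPolynomial.eval x p = 0) ∧ ∀ q ∈ A.neqs, MvPolynomial.eval x q ≠ 0}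

/-- The projection `proj_k zero_q (P / Q)` that forgets the last coordinate, for `k = n + 1`. -/
def projZeroq {F : Type*} [Field F] {n : ℕ} (A : PolySystem (MvPolynomial (Fin (n + 1)) F)) :
    Set (Fin n → F) :=
  {a | ∃ b : F, (Fin.snoc a b : Fin (n + 1) → F) ∈ zeroq A}

/-- The finite set `Δ` of systems in one variable less is a weak projecting zero decomposition of
`A` for the point `α`. -/
def IsWeakProjectingZeroDecomposition {F : Type*} [Field F] {n : ℕ}
    (A : PolySystem (MvPolynomial (Fin (n + 1)) F)) (α : Fin n → F)
    (Δ : Finset (PolySystem (MvPolynomial (Fin n) F))) : Prop :=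
  (projZeroq A ⊆ ⋃ B ∈ Δ, zeroq B) ∧ ∀ B ∈ Δ, α ∉ zeroq B

/-- The identification `F[x_1, …, x_{n+1}] = F[x_1, …, x_n][X]`, with `X` the last variable. -/
noncomputable def toUnivariate {F : Type*} [Field F] {n : ℕ} :
    MvPolynomial (Fin (n + 1)) F →ₐ[F] (MvPolynomial (Fin n) F)[X] :=
  MvPolynomial.aeval (Fin.lastCases X fun i => C (MvPolynomial.X i))

open scoped Classical in
/-- A system in `x_1, …, x_{n+1}`, seen as a system of polynomials in the last variable. -/
noncomputable def PolySystem.toUnivariate {F : Type*} [Field F] {n : ℕ}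
    (A : PolySystem (MvPolynomial (Fin (n + 1)) F)) : PolySystem (MvPolynomial (Fin n) F)[X] :=
  ⟨A.eqs.image _root_.toUnivariate, A.neqs.image _root_.toUnivariate⟩

/-! ### Pseudo-division -/

/-- Pseudo-division of `g` by `f` in `s` elimination steps; it returns the pair `(o, r)`. If
`deg g < deg f + s`, then `lc(f) ^ s * g = o * f + r` with `deg r < deg f`. -/
noncomputable def pseudoDivAux {R : Type*} [CommRing R] (f : R[X]) : ℕ → R[X] → R[X] × R[X]
  | 0, g => (0, g)
  | s + 1, g =>
    let c := g.coeff (f.natDegree + s)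
    let D := pseudoDivAux f s (C f.leadingCoeff * g - C c * X ^ s * f)
    (D.1 + C f.leadingCoeff ^ s * (C c * X ^ s), D.2)

/-- The pseudo-quotient of `g` with respect to `f`: the `o` of the pseudo-remainder formula
`lc(f) ^ d * g = o * f + r` with `d = max (deg g - deg f + 1) 0` and `deg r < deg f`. -/
noncomputable def pquo {R : Type*} [CommRing R] (g f : R[X]) : R[X] :=
  (pseudoDivAux f (g.natDegree + 1 - f.natDegree) g).1

theorem pseudoDivAux_spec {R : Type*} [CommRing R] (f : R[X]) (hf : f ≠ 0) (s : ℕ) (g : R[X])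
    (hg : g.degree < ((f.natDegree + s : ℕ) : WithBot ℕ)) :
    C f.leadingCoeff ^ s * g = (pseudoDivAux f s g).1 * f + (pseudoDivAux f s g).2 ∧
      (pseudoDivAux f s g).2.degree < f.degree := by
  induction s generalizing g with
  | zero =>
    rw [Polynomial.degree_eq_natDegree hf]
    simpa [pseudoDivAux] using hg
  | succ s ih =>
    have key : (C f.leadingCoeff * g - C (g.coeff (f.natDegree + s)) * X ^ s * f).degree
        < ((f.natDegree + s : ℕ) : WithBot ℕ) := by
      rw [Polynomial.degree_lt_iff_coeff_zero] at hg ⊢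
      intro m hm
      rcases Nat.eq_or_lt_of_le hm with h | h
      · subst h
        simp only [coeff_sub, coeff_C_mul, mul_assoc, coeff_X_pow_mul]
        rw [Polynomial.coeff_natDegree]; ring
      · have h1 : g.coeff m = 0 := hg m (by omega)
        obtain ⟨j, rfl⟩ : ∃ j, m = j + s := ⟨m - s, by omega⟩
        have h2 : f.coeff j = 0 := Polynomial.coeff_eq_zero_of_natDegree_lt (by omega)
        simp [coeff_sub, coeff_C_mul, mul_assoc, coeff_X_pow_mul, h1, h2]
    obtain ⟨h1, h2⟩ := ih _ key
    refine ⟨?_, h2⟩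
    simp only [pseudoDivAux]
    linear_combination h1

theorem pquo_spec {R : Type*} [CommRing R] (g f : R[X]) (hf : f ≠ 0) :
    ∃ r : R[X], C f.leadingCoeff ^ (g.natDegree + 1 - f.natDegree) * g = pquo g f * f + r ∧
      r.degree < f.degree := by
  refine ⟨_, pseudoDivAux_spec f hf _ g ?_⟩
  refine lt_of_le_of_lt Polynomial.degree_le_natDegree ?_
  exact_mod_cast (by omega : g.natDegree < f.natDegree + (g.natDegree + 1 - f.natDegree))

/-! ### Subresultants and the subresultant regular subchain

Below, `f` and `g` are polynomials in the main variable with `m = deg f ≥ l = deg g > 0`. -/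

/-- The square submatrix `M_{ij}` of the Sylvester matrix of `f` and `g`, of size `m + l - 2 j`:
its rows are the coefficient vectors of `X ^ (l-j-1) f, …, f, X ^ (m-j-1) g, …, g`, its columns
belong to the powers `X ^ (m+l-j-1), …, X ^ (j+1)` and, for the last column, to `X ^ i`. -/
noncomputable def sylvesterMinor {R : Type*} [CommRing R] (f g : R[X]) (i j : ℕ) :
    Matrix (Fin (f.natDegree + g.natDegree - 2 * j)) (Fin (f.natDegree + g.natDegree - 2 * j)) R :=
  fun a b =>
    (if (a : ℕ) < g.natDegree - j then X ^ (g.natDegree - j - 1 - a) * f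
      else X ^ (f.natDegree - j - 1 - (a - (g.natDegree - j))) * g).coeff
      (if (b : ℕ) + 1 = f.natDegree + g.natDegree - 2 * j then i
        else f.natDegree + g.natDegree - j - 1 - b)

/-- The `j`-th subresultant `∑_{i ≤ j} det M_{ij} X ^ i` of `f` and `g`, for `j < l`. -/
noncomputable def subresultant {R : Type*} [CommRing R] (f g : R[X]) (j : ℕ) : R[X] :=
  ∑ i ∈ Finset.range (j + 1), C (sylvesterMinor f g i j).det * X ^ i

/-- The index `μ` of the first entry after `f` of the subresultant chain:
`μ = m - 1` if `m > l`, and `μ = l` if `m = l`. -/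
noncomputable def chainTop {R : Type*} [CommRing R] (f g : R[X]) : ℕ :=
  if g.natDegree < f.natDegree then f.natDegree - 1 else g.natDegree

/-- The entry `S_j`, `j ≤ μ`, of the subresultant chain `S_{μ+1} = f, S_μ = g, S_{μ-1}, …, S_0`:
for `j < μ` it is the `j`-th subresultant, which is `lc(g) ^ (m-l-1) g` for `j = l`
and `0` for `l < j`. -/
noncomputable def subresultantChain {R : Type*} [CommRing R] (f g : R[X]) (j : ℕ) : R[X] :=
  if j = chainTop f g then g
  else if j < g.natDegree then subresultant f g j
  else if j = g.natDegree then C g.leadingCoeff ^ (f.natDegree - g.natDegree - 1) * g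
  else 0

open scoped Classical in
/-- The subresultant regular subchain `h_2, …, h_r` of `f` and `g`: the regular entries `S_j`, that
is, those with `deg S_j = j`, among `S_μ, …, S_0`, in this order. (The zero polynomial has degree
`⊥`, so `S_0 = 0` is not regular.) -/
noncomputable def srs {R : Type*} [CommRing R] (f g : R[X]) : List R[X] :=
  ((List.range (chainTop f g + 1)).reverse.filter
    fun j => (subresultantChain f g j).degree = (j : WithBot ℕ)).map (subresultantChain f g)

/-- The subresultant regular subchain of two polynomials of positive degree, with the one of larger
degree taken first. -/
noncomputable def srsOrdered {R : Type*} [CommRing R] (f g : R[X]) : List R[X] :=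
  if g.natDegree ≤ f.natDegree then srs f g else srs g f

/-! ### The algorithm

The algorithm works on systems over `F[x_1, …, x_{k-1}][X]`, where `k = n + 1` and `X = x_k`, and it
returns systems over `F[x_1, …, x_{k-1}]`. A polynomial is free of `x_k` if its `natDegree` is `0`;
it is then identified with its coefficient `coeff 0`. -/

/-- A polynomial constraint `p = 0` or `p ≠ 0`. -/
inductive PolyConstraint (R : Type*) where
  | eqZero (p : R)
  | neZero (p : R)

namespace PolyConstraint

/-- The negated constraint. -/
def neg {R : Type*} : PolyConstraint R → PolyConstraint R
  | eqZero p => neZero p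
  | neZero p => eqZero p

/-- The system that consists of a single constraint. -/
def toSystem {R : Type*} : PolyConstraint R → PolySystem R
  | eqZero p => ⟨{p}, ∅⟩
  | neZero p => ⟨∅, {p}⟩

/-- The constraint evaluates to true at `α`. -/
def HoldsAt {F : Type*} [Field F] {n : ℕ} (α : Fin n → F) :
    PolyConstraint (MvPolynomial (Fin n) F) → Prop
  | eqZero p => MvPolynomial.eval α p = 0
  | neZero p => MvPolynomial.eval α p ≠ 0

end PolyConstraint

namespace PReg

/-- `P̂`: the polynomials of `P` in which the main variable occurs. -/
def hat {R : Type*} [CommRing R] (P : Finset R[X]) : Finset R[X] :=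
  P.filter fun p => 0 < p.natDegree

open scoped Classical in
/-- Execution of a sequence of statements "return (the recursive call on `B`) if `c`" that is
followed by unconditional recursive calls on the systems in `last`. The first component is the set
of tracked constraints, each one as a system of its own: a guard that is false at `α` is tracked,
and of a guard that is true at `α` the negation is tracked. The second component is the set of
the systems on which recursive calls are made. -/
noncomputable def runGuards {F : Type*} [Field F] {n : ℕ} (α : Fin n → F)
    (last : Finset (PolySystem (MvPolynomial (Fin n) F)[X])) :
    List (PolyConstraint (MvPolynomial (Fin n) F) × PolySystem (MvPolynomial (Fin n) F)[X]) →
      Finset (PolySystem (MvPolynomial (Fin n) F)) × Finset (PolySystem (MvPolynomial (Fin n) F)[X])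
  | [] => (∅, last)
  | (c, B) :: G =>
    if c.HoldsAt α then ({c.neg.toSystem}, {B})
    else (insert c.toSystem (runGuards α last G).1, (runGuards α last G).2)

open scoped Classical in
/-- The polynomials `c - c(α)`, where `c` runs over the (nonzero) coefficients of `p` with respect
to the main variable. The single-polynomial projection of `p` consists of the
systems `(∅, {c - c(α)})`. -/
noncomputable def projCoeff {F : Type*} [Field F] {n : ℕ} (α : Fin n → F)
    (p : (MvPolynomial (Fin n) F)[X]) : Finset (MvPolynomial (Fin n) F) :=
  p.support.image fun d => p.coeff d - MvPolynomial.C (MvPolynomial.eval α (p.coeff d))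

open scoped Classical in
/-- The systems `(P, Q) ∪ B`, where `B` runs over the single-polynomial projection of `p`. -/
noncomputable def projCoeffCalls {F : Type*} [Field F] {n : ℕ} (α : Fin n → F)
    (P Q : Finset (MvPolynomial (Fin n) F)[X]) (p : (MvPolynomial (Fin n) F)[X]) :
    Finset (PolySystem (MvPolynomial (Fin n) F)[X]) :=
  (projCoeff α p).image fun u => ⟨P, insert (C u) Q⟩

open scoped Classical in
/-- The leading coefficients of the polynomials in a list, as polynomials free of the main
variable. -/
noncomputable def lcs {R : Type*} [CommRing R] (H : List R[X]) : Finset R[X] :=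
  (H.map fun h => C h.leadingCoeff).toFinset

open scoped Classical in
/-- The guarded recursive call for `p ∈ P̂` with `lc(p)(α) = 0`, in which `p` is replaced by its
reductum. -/
noncomputable def reductumGuard {R : Type*} [CommRing R] (P Q : Finset R[X]) (p : R[X]) :
    PolyConstraint R × PolySystem R[X] :=
  (.eqZero p.leadingCoeff, ⟨insert p.eraseLead (P.erase p), Q⟩)

open scoped Classical in
/-- The guarded recursive calls for two polynomials `p, p' ∈ P̂`. The list `H` is `h_2, …, h_r`, so
`h_i` is the entry of `H` with (zero-based) position `i - 2`. If `h_r` is free of `x_k`, then the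
loop leaves out the two last indices; the lists `l_{i+1}, …, l_r` reach up to the last entry of the
subchain in any case, so that `h_i` is a specialised gcd on the zeros of the new system. -/
noncomputable def eqGuards {R : Type*} [CommRing R] (P Q : Finset R[X]) (p p' : R[X]) :
    List (PolyConstraint R × PolySystem R[X]) :=
  let H := srs p' p
  let P₀ := (P.erase p).erase p'
  let loop (m : ℕ) := (List.range m).reverse.map fun i =>
    (PolyConstraint.neZero (H.getD i 0).leadingCoeff,
      (⟨insert (H.getD i 0) (P₀ ∪ lcs (H.drop (i + 1))), Q⟩ : PolySystem R[X]))
  if (H.getLastD 0).natDegree = 0 then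
    (.neZero (H.getD (H.length - 2) 0).leadingCoeff,
      ⟨insert (H.getLastD 0) (insert (H.getD (H.length - 2) 0) P₀), Q⟩) :: loop (H.length - 2)
  else loop H.length

open scoped Classical in
/-- The guarded recursive calls for `p`, the only polynomial in `P̂`, and `q ∈ Q̂`. Again `H` is
`h_2, …, h_r`. If `h_r` is free of `x_k`, then the loop leaves out the last index; again the
lists `l_{i+1}, …, l_r` reach up to the last entry of the subchain. -/
noncomputable def neqGuards {R : Type*} [CommRing R] (P Q : Finset R[X]) (p q : R[X]) :
    List (PolyConstraint R × PolySystem R[X]) :=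
  let H := srsOrdered q p
  let P₀ := P.erase p
  let loop (m : ℕ) := (List.range m).reverse.map fun i =>
    (PolyConstraint.neZero (H.getD i 0).leadingCoeff,
      (⟨insert (pquo p (H.getD i 0)) (P₀ ∪ lcs (H.drop (i + 1))), Q⟩ : PolySystem R[X]))
  if (H.getLastD 0).natDegree = 0 then
    (.neZero (H.getLastD 0).leadingCoeff,
      ⟨insert (pquo p (H.getLastD 0)) P₀, Q.erase q⟩) :: loop (H.length - 1)
  else loop H.length

open scoped Classical in
/-- The guarded recursive call for `q ∈ Q̂` with `lc(q)(α) = 0`, in which `q` is replaced by its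
reductum. -/
noncomputable def neqReductumGuard {R : Type*} [CommRing R] (P Q : Finset R[X]) (q : R[X]) :
    PolyConstraint R × PolySystem R[X] :=
  (.eqZero q.leadingCoeff, ⟨P, insert q.eraseLead (Q.erase q)⟩)

/-- The algorithm stops at the equation `p`: it is free of `x_k` and excludes `α`. -/
def ExcludesEq {F : Type*} [Field F] {n : ℕ} (α : Fin n → F)
    (A : PolySystem (MvPolynomial (Fin n) F)[X]) (p : (MvPolynomial (Fin n) F)[X]) : Prop :=
  p ∈ A.eqs ∧ p.natDegree = 0 ∧ MvPolynomial.eval α (p.coeff 0) ≠ 0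

/-- The algorithm stops at the disequation `q`: it is free of `x_k` and excludes `α`. -/
def ExcludesNeq {F : Type*} [Field F] {n : ℕ} (α : Fin n → F)
    (A : PolySystem (MvPolynomial (Fin n) F)[X]) (q : (MvPolynomial (Fin n) F)[X]) : Prop :=
  q ∈ A.neqs ∧ q.natDegree = 0 ∧ MvPolynomial.eval α (q.coeff 0) = 0

/-- The polynomial `p` is one of those that the algorithm may select from `P`: no polynomial of
the system excludes `α` directly, and `p` has the smallest positive degree in `x_k` in `P`. -/
def SelectsEq {F : Type*} [Field F] {n : ℕ} (α : Fin n → F)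
    (A : PolySystem (MvPolynomial (Fin n) F)[X]) (p : (MvPolynomial (Fin n) F)[X]) : Prop :=
  (∀ u, ¬ ExcludesEq α A u) ∧ (∀ u, ¬ ExcludesNeq α A u) ∧
    p ∈ hat A.eqs ∧ ∀ u ∈ hat A.eqs, p.natDegree ≤ u.natDegree

open scoped Classical in
/-- `Body α A Δ Bs`: for some admissible choice of the polynomials that are to be selected, the body
of the algorithm, executed on the system `A` and the point `α`, contributes the systems `Δ` to
the result and makes recursive calls on exactly the systems in `Bs`. A body that would end without
reaching a return statement is not an execution in this sense. -/
inductive Body {F : Type*} [Field F] {n : ℕ} (α : Fin n → F)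
    (A : PolySystem (MvPolynomial (Fin n) F)[X]) :
    Finset (PolySystem (MvPolynomial (Fin n) F)) →
      Finset (PolySystem (MvPolynomial (Fin n) F)[X]) → Prop
  /-- Some equation excludes `α`. -/
  | returnEq (p : (MvPolynomial (Fin n) F)[X]) (hp : ExcludesEq α A p) :
      Body α A {⟨{p.coeff 0}, ∅⟩} ∅
  /-- Otherwise, some disequation excludes `α`. -/
  | returnNeq (q : (MvPolynomial (Fin n) F)[X]) (hP : ∀ u, ¬ ExcludesEq α A u)
      (hq : ExcludesNeq α A q) :
      Body α A {⟨∅, {q.coeff 0}⟩} ∅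
  /-- Otherwise, `P̂` has at least two elements. -/
  | twoEqs (p p' : (MvPolynomial (Fin n) F)[X]) (hp : SelectsEq α A p)
      (hp' : p' ∈ (hat A.eqs).erase p)
      (Δ : Finset (PolySystem (MvPolynomial (Fin n) F)))
      (Bs : Finset (PolySystem (MvPolynomial (Fin n) F)[X]))
      (hE : runGuards α (projCoeffCalls α A.eqs A.neqs p)
        (reductumGuard A.eqs A.neqs p :: eqGuards A.eqs A.neqs p p') = (Δ, Bs)) :
      Body α A Δ Bs
  /-- `P̂` has exactly one element and `Q̂` is not empty. -/
  | eqNeq (p q : (MvPolynomial (Fin n) F)[X]) (hp : SelectsEq α A p) (hP : hat A.eqs = {p})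
      (hq : q ∈ hat A.neqs)
      (Δ : Finset (PolySystem (MvPolynomial (Fin n) F)))
      (Bs : Finset (PolySystem (MvPolynomial (Fin n) F)[X]))
      (hE : runGuards α (projCoeffCalls α A.eqs A.neqs p)
        (reductumGuard A.eqs A.neqs p :: neqGuards A.eqs A.neqs p q) = (Δ, Bs)) :
      Body α A Δ Bs
  /-- `P̂` has exactly one element and `Q̂` is empty. -/
  | oneEq (p : (MvPolynomial (Fin n) F)[X]) (hp : SelectsEq α A p) (hP : hat A.eqs = {p})
      (hQ : hat A.neqs = ∅)
      (Δ : Finset (PolySystem (MvPolynomial (Fin n) F)))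
      (Bs : Finset (PolySystem (MvPolynomial (Fin n) F)[X]))
      (hE : runGuards α (projCoeffCalls α A.eqs A.neqs p) [reductumGuard A.eqs A.neqs p] = (Δ, Bs)) :
      Body α A Δ Bs
  /-- `P̂` is empty and `Q̂` is not; the loop runs through `Q̂` in the order of the list `L`. -/
  | neqs (L : List (MvPolynomial (Fin n) F)[X]) (hU : ∀ u, ¬ ExcludesEq α A u)
      (hN : ∀ u, ¬ ExcludesNeq α A u) (hP : hat A.eqs = ∅) (hQ : (hat A.neqs).Nonempty)
      (hL : L.Nodup) (hLQ : L.toFinset = hat A.neqs)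
      (Δ : Finset (PolySystem (MvPolynomial (Fin n) F)))
      (Bs : Finset (PolySystem (MvPolynomial (Fin n) F)[X]))
      (hE : runGuards α
        (projCoeffCalls α A.eqs (A.neqs \ hat A.neqs) (∏ q ∈ hat A.neqs, q))
        (L.map (neqReductumGuard A.eqs A.neqs)) = (Δ, Bs)) :
      Body α A Δ Bs

/-- Every execution of the algorithm on the system `A` and the point `α` terminates, whatever
selections are made: the body can be executed up to a return statement, and every recursive call
that it makes terminates in the same sense. As the predicate is inductive, there is no infinite
chain of recursive calls. -/
inductive Terminates {F : Type*} [Field F] {n : ℕ} (α : Fin n → F) :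
    PolySystem (MvPolynomial (Fin n) F)[X] → Prop
  | intro (A : PolySystem (MvPolynomial (Fin n) F)[X]) (hA : ∃ Δ Bs, Body α A Δ Bs)
      (h : ∀ Δ Bs, Body α A Δ Bs → ∀ B ∈ Bs, Terminates α B) : Terminates α A

open scoped Classical in
/-- `Returns α A Δ`: some execution of the algorithm on the system `A` and the point `α` returns
the set `Δ` of systems. -/
inductive Returns {F : Type*} [Field F] {n : ℕ} (α : Fin n → F) :
    PolySystem (MvPolynomial (Fin n) F)[X] → Finset (PolySystem (MvPolynomial (Fin n) F)) → Prop
  | intro (A : PolySystem (MvPolynomial (Fin n) F)[X])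
      (Δ : Finset (PolySystem (MvPolynomial (Fin n) F)))
      (Bs : Finset (PolySystem (MvPolynomial (Fin n) F)[X]))
      (R : PolySystem (MvPolynomial (Fin n) F)[X] → Finset (PolySystem (MvPolynomial (Fin n) F)))
      (hA : Body α A Δ Bs) (hR : ∀ B ∈ Bs, Returns α B (R B)) :
      Returns α A (Δ ∪ Bs.biUnion R)

end PReg

/-!
Fix a point `ξ` of the base and let `σ` be the evaluation of the coefficients at `ξ`. The proof rests
on one fact about the subresultant regular subchain `h_2, …, h_r` of two polynomials `f`, `g`: if `σ`
does not kill both leading coefficients, then the last `h_i` whose leading coefficient survives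
specialises to a gcd of `σ f` and `σ g` (`map_srsOrdered_dvd`), and if none survives, then the
polynomial of lower degree specialises to zero (`map_eq_zero_of_srsOrdered`). No structure theorem on
subresultant chains is needed for this. Each subresultant lies in the ideal of `f` and `g`
(`subresultant_mem_span`), so the specialised gcd divides it. Conversely, a vanishing principal minor
`det M_jj` yields a combination `U f + V g` of degree below `j` with small cofactors
(`exists_cofactors_of_det_eq_zero`). If the gcd had degree `j`, this combination would be zero, which
the bounds on the cofactors exclude; so if the minors vanish for all `j < k`, then the gcd has degree
at least `k` (`le_natDegree_gcd_map`). The leading coefficients of the regular entries below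
`deg g` are exactly the nonzero principal minors.

In each statement of the algorithm, therefore, the zeros above `ξ` do not change when a guard holds at
`ξ` after its predecessors have failed there. This is `PReg.GuardsSound`. Applied at `ξ = α`, it shows
that the recursive calls again have no zero above `α`; applied at any other `ξ`, it shows that `ξ`
either passes the guards in the same way as `α`, and then its zeros pass to the recursive call, or it
satisfies one of the tracked constraints. The concluding calls with the single-polynomial
projection return at once, since `c - c(α)` vanishes at `α`. They cover what is left, because a point
over which all coefficients agree with those over `α` would give a zero above `α`.

All other recursive calls lower the sum of the degrees in the main variable (`PReg.degreeSum`), which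
gives termination; the body never ends without a return statement, because a system without a
selectable polynomial in which nothing excludes `α` has zeros above `α`.
-/

/-! ### Subresultants under specialisation -/

section Subresultants

variable {R : Type*} [CommRing R] {K : Type*} [Field K]

/-- The polynomial whose coefficients form row `a` of the minors `M_ij` of the Sylvester matrix. -/
noncomputable def sylvesterRow (f g : R[X]) (j a : ℕ) : R[X] :=
  if a < g.natDegree - j then X ^ (g.natDegree - j - 1 - a) * f
  else X ^ (f.natDegree - j - 1 - (a - (g.natDegree - j))) * g

theorem sylvesterMinor_self_apply {f g : R[X]} {j : ℕ}
    (a b : Fin (f.natDegree + g.natDegree - 2 * j)) :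
    sylvesterMinor f g j j a b
      = (sylvesterRow f g j a).coeff (f.natDegree + g.natDegree - j - 1 - b) := by
  have hb := b.isLt
  unfold sylvesterMinor sylvesterRow
  congr 1
  split_ifs <;> omega

theorem sylvesterRow_coeff_eq_zero {f g : R[X]} {j a i : ℕ} (hj : j < g.natDegree)
    (hgf : g.natDegree ≤ f.natDegree)
    (hi : f.natDegree + g.natDegree - j ≤ i) : (sylvesterRow f g j a).coeff i = 0 := by
  unfold sylvesterRow
  split_ifs
  · rw [coeff_X_pow_mul', if_pos (by omega)]
    exact coeff_eq_zero_of_natDegree_lt (by omega)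
  · rw [coeff_X_pow_mul', if_pos (by omega)]
    exact coeff_eq_zero_of_natDegree_lt (by omega)

/-- Only the last column of the minor depends on `i`; expanding along it, the cofactors are
entries of the adjugate of the principal minor. -/
theorem det_sylvesterMinor {f g : R[X]} {j : ℕ} (i : ℕ)
    (z : Fin (f.natDegree + g.natDegree - 2 * j))
    (hz : (z : ℕ) + 1 = f.natDegree + g.natDegree - 2 * j) :
    (sylvesterMinor f g i j).det
      = ∑ a, (sylvesterMinor f g j j).adjugate z a * (sylvesterRow f g j a).coeff i := by
  have h : sylvesterMinor f g i j
      = (sylvesterMinor f g j j).updateCol z fun a => (sylvesterRow f g j a).coeff i := by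
    ext a b
    rw [Matrix.updateCol_apply]
    by_cases hb : b = z
    · subst hb
      simp [sylvesterMinor, sylvesterRow, hz]
    · have : ¬ (b : ℕ) + 1 = f.natDegree + g.natDegree - 2 * j :=
        fun h => hb (Fin.ext (by omega))
      simp [sylvesterMinor, hb, this]
  rw [h, ← Matrix.cramer_apply, Matrix.cramer_eq_adjugate_mulVec]
  rfl

theorem subresultant_eq_sum {f g : R[X]} {j : ℕ} (hj : j < g.natDegree)
    (hgf : g.natDegree ≤ f.natDegree)
    (z : Fin (f.natDegree + g.natDegree - 2 * j))
    (hz : (z : ℕ) + 1 = f.natDegree + g.natDegree - 2 * j) :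
    subresultant f g j
      = ∑ a, C ((sylvesterMinor f g j j).adjugate z a) * sylvesterRow f g j a := by
  ext i
  simp only [subresultant, finsetSum_coeff, coeff_C_mul, coeff_X_pow, mul_ite, mul_one, mul_zero,
    Finset.sum_ite_eq, Finset.mem_range]
  split_ifs with hi
  · exact det_sylvesterMinor i z hz
  · by_cases hi' : i < f.natDegree + g.natDegree - j
    · -- the coefficient at `X ^ i` is a minor with two equal columns
      have hb : f.natDegree + g.natDegree - j - 1 - i < f.natDegree + g.natDegree - 2 * j := by
        omega
      have h := congrFun (congrFun (Matrix.adjugate_mul (sylvesterMinor f g j j)) z) ⟨_, hb⟩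
      have hne : z ≠ ⟨_, hb⟩ := fun h => by
        have := congrArg Fin.val h
        simp only at this
        omega
      rw [Matrix.mul_apply, Matrix.smul_apply, Matrix.one_apply_ne hne, smul_zero] at h
      rw [← h]
      refine Finset.sum_congr rfl fun a _ => ?_
      rw [sylvesterMinor_self_apply]
      congr 2
      simp only
      omega
    · refine (Finset.sum_eq_zero fun a _ => ?_).symm
      rw [sylvesterRow_coeff_eq_zero hj hgf (by omega), mul_zero]

theorem sylvesterRow_mem_span (f g : R[X]) (j a : ℕ) :
    sylvesterRow f g j a ∈ Ideal.span {f, g} := by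
  unfold sylvesterRow
  split_ifs
  · exact Ideal.mul_mem_left _ _ (Ideal.subset_span (by simp))
  · exact Ideal.mul_mem_left _ _ (Ideal.subset_span (by simp))

theorem subresultant_mem_span {f g : R[X]} {j : ℕ} (hj : j < g.natDegree)
    (hgf : g.natDegree ≤ f.natDegree) : subresultant f g j ∈ Ideal.span {f, g} := by
  rw [subresultant_eq_sum hj hgf ⟨f.natDegree + g.natDegree - 2 * j - 1, by omega⟩
    (by simp only; omega)]
  exact Ideal.sum_mem _ fun a _ => Ideal.mul_mem_left _ _ (sylvesterRow_mem_span f g j a)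

theorem subresultant_coeff_self (f g : R[X]) (j : ℕ) :
    (subresultant f g j).coeff j = (sylvesterMinor f g j j).det := by
  simp [subresultant, coeff_X_pow]

theorem subresultant_degree_le (f g : R[X]) (j : ℕ) : (subresultant f g j).degree ≤ j := by
  refine (degree_sum_le _ _).trans (Finset.sup_le fun i hi => ?_)
  refine (degree_C_mul_X_pow_le _ _).trans ?_
  exact_mod_cast Nat.lt_succ_iff.mp (Finset.mem_range.mp hi)

theorem subresultant_degree_eq_iff (f g : R[X]) (j : ℕ) :
    (subresultant f g j).degree = j ↔ (sylvesterMinor f g j j).det ≠ 0 := by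
  rw [← subresultant_coeff_self]
  constructor
  · exact fun h => coeff_ne_zero_of_eq_degree h
  · exact fun h => le_antisymm (subresultant_degree_le f g j) (le_degree_of_ne_zero h)

/-- Sylvester's criterion: a linear dependence between the rows of the specialised principal
minor is a combination of `f` and `g` with small cofactors and degree below `j`. -/
theorem exists_cofactors_of_det_eq_zero {f g : R[X]} {j : ℕ} (hj : j < g.natDegree)
    (hgf : g.natDegree ≤ f.natDegree) (σ : R →+* K)
    (h : σ (sylvesterMinor f g j j).det = 0) :
    ∃ U V : K[X], (U ≠ 0 ∨ V ≠ 0) ∧ U.degree < (g.natDegree - j : ℕ) ∧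
      V.degree < (f.natDegree - j : ℕ) ∧ (U * f.map σ + V * g.map σ).degree < j := by
  rw [RingHom.map_det, ← Matrix.exists_vecMul_eq_zero_iff] at h
  obtain ⟨w, hw, hw0⟩ := h
  obtain ⟨m, hm⟩ : ∃ m, m = f.natDegree - j := ⟨_, rfl⟩
  obtain ⟨l, hl⟩ : ∃ l, l = g.natDegree - j := ⟨_, rfl⟩
  have hN : l + m = f.natDegree + g.natDegree - 2 * j := by omega
  -- the coordinates of the dependence on the shifts of `f` and of `g`
  let u : ℕ → K := fun a => if ha : a < f.natDegree + g.natDegree - 2 * j then w ⟨a, ha⟩ else 0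
  let U : K[X] := ∑ a ∈ Finset.range l, C (u a) * X ^ (l - 1 - a)
  let V : K[X] := ∑ a ∈ Finset.range m, C (u (l + a)) * X ^ (m - 1 - a)
  have hUc : ∀ a < l, U.coeff (l - 1 - a) = u a := by
    intro a ha
    simp only [U, finsetSum_coeff, coeff_C_mul, coeff_X_pow]
    rw [Finset.sum_eq_single a]
    · simp
    · intro b hb hba
      rw [if_neg (by have := Finset.mem_range.mp hb; omega), mul_zero]
    · intro hb; exact absurd (Finset.mem_range.mpr ha) hb
  have hVc : ∀ a < m, V.coeff (m - 1 - a) = u (l + a) := by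
    intro a ha
    simp only [V, finsetSum_coeff, coeff_C_mul, coeff_X_pow]
    rw [Finset.sum_eq_single a]
    · simp
    · intro b hb hba
      rw [if_neg (by have := Finset.mem_range.mp hb; omega), mul_zero]
    · intro hb; exact absurd (Finset.mem_range.mpr ha) hb
  have hUV : U * f.map σ + V * g.map σ
      = ∑ a : Fin (f.natDegree + g.natDegree - 2 * j),
          C (w a) * (sylvesterRow f g j a).map σ := by
    have h1 : ∑ a : Fin (f.natDegree + g.natDegree - 2 * j),
        C (w a) * (sylvesterRow f g j a).map σ
          = ∑ a ∈ Finset.range (f.natDegree + g.natDegree - 2 * j),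
            C (u a) * (sylvesterRow f g j a).map σ := by
      rw [Finset.sum_range]
      exact Finset.sum_congr rfl fun a _ => by simp [u]
    rw [h1, ← hN, Finset.sum_range_add, Finset.sum_mul, Finset.sum_mul]
    congr 1
    · refine Finset.sum_congr rfl fun a ha => ?_
      rw [sylvesterRow, if_pos (hl ▸ Finset.mem_range.mp ha), hl]
      simp [mul_assoc]
    · refine Finset.sum_congr rfl fun a ha => ?_
      rw [sylvesterRow, if_neg (by omega), ← hl, ← hm, Nat.add_sub_cancel_left]
      simp [mul_assoc]
  refine ⟨U, V, ?_, ?_, ?_, ?_⟩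
  · by_contra! hc
    refine hw (funext fun a => ?_)
    have ha := a.isLt
    have hua : u a = w a := by simp [u]
    rw [← hua, Pi.zero_apply]
    by_cases hal : (a : ℕ) < l
    · rw [← hUc a hal, hc.1, coeff_zero]
    · obtain ⟨b, hb⟩ := Nat.exists_eq_add_of_le (not_lt.mp hal)
      rw [hb, ← hVc b (by omega), hc.2, coeff_zero]
  · rw [degree_lt_iff_coeff_zero]
    intro i hi
    simp only [U, finsetSum_coeff, coeff_C_mul, coeff_X_pow]
    refine Finset.sum_eq_zero fun a ha => ?_
    rw [if_neg (by have := Finset.mem_range.mp ha; omega), mul_zero]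
  · rw [degree_lt_iff_coeff_zero]
    intro i hi
    simp only [V, finsetSum_coeff, coeff_C_mul, coeff_X_pow]
    refine Finset.sum_eq_zero fun a ha => ?_
    rw [if_neg (by have := Finset.mem_range.mp ha; omega), mul_zero]
  · rw [hUV, degree_lt_iff_coeff_zero]
    intro i hi
    simp only [finsetSum_coeff, coeff_C_mul, coeff_map]
    by_cases hi' : i < f.natDegree + g.natDegree - j
    · have hb : f.natDegree + g.natDegree - j - 1 - i < f.natDegree + g.natDegree - 2 * j := by
        omega
      have h := congrFun hw0 ⟨_, hb⟩
      rw [Pi.zero_apply] at h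
      rw [← h, Matrix.vecMul, dotProduct]
      refine Finset.sum_congr rfl fun a _ => ?_
      rw [RingHom.mapMatrix_apply, Matrix.map_apply, sylvesterMinor_self_apply]
      congr 3
      simp only
      omega
    · refine Finset.sum_eq_zero fun a _ => ?_
      rw [sylvesterRow_coeff_eq_zero hj hgf (by omega), map_zero, mul_zero]

/-- For coprime `a` and `b`, the syzygies of `(a, b)` are the multiples of `(b, -a)`, so one with
`deg V < deg a` is zero. -/
theorem eq_zero_of_mul_add_mul_eq_zero {a b U V : K[X]} (hab : IsCoprime a b) (ha : a ≠ 0)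
    (h : U * a + V * b = 0) (hV : V.degree < a.degree) : U = 0 ∧ V = 0 := by
  have hdvd : a ∣ V := hab.dvd_of_dvd_mul_right ⟨-U, by linear_combination h⟩
  have hV0 : V = 0 := eq_zero_of_dvd_of_degree_lt hdvd hV
  subst hV0
  refine ⟨?_, rfl⟩
  simpa [ha] using h

open scoped Classical in
/-- If the principal minors below `k` vanish under a specialisation that preserves the degree of `f`
or of `g`, then the specialised polynomials have a common divisor of degree at least `k`. One
preserved degree suffices: it bounds one of the two cofactors. -/
theorem le_natDegree_gcd_map {f g : R[X]} (hgf : g.natDegree ≤ f.natDegree) (σ : R →+* K)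
    (hlc : σ f.leadingCoeff ≠ 0 ∨ σ g.leadingCoeff ≠ 0) {k : ℕ} (hk : k ≤ g.natDegree)
    (h : ∀ j < k, σ (sylvesterMinor f g j j).det = 0) :
    k ≤ (EuclideanDomain.gcd (f.map σ) (g.map σ)).natDegree := by
  by_contra! hlt
  set G := EuclideanDomain.gcd (f.map σ) (g.map σ) with hG
  have hfg : f.map σ ≠ 0 ∨ g.map σ ≠ 0 := by
    refine hlc.imp (fun h0 h => h0 ?_) (fun h0 h => h0 ?_)
    · simpa using congrArg (fun p => coeff p f.natDegree) h
    · simpa using congrArg (fun p => coeff p g.natDegree) h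
  have hG0 : G ≠ 0 := by
    intro h0
    rw [hG, EuclideanDomain.gcd_eq_zero_iff] at h0
    exact hfg.elim (· h0.1) (· h0.2)
  obtain ⟨U, V, hne, hU, hV, hW⟩ :=
    exists_cofactors_of_det_eq_zero (hlt.trans_le hk) hgf σ (h _ hlt)
  obtain ⟨a, ha⟩ : G ∣ f.map σ := EuclideanDomain.gcd_dvd_left _ _
  obtain ⟨b, hb⟩ : G ∣ g.map σ := EuclideanDomain.gcd_dvd_right _ _
  have hab : IsCoprime a b := by
    have hbez := EuclideanDomain.gcd_eq_gcd_ab (f.map σ) (g.map σ)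
    refine ⟨EuclideanDomain.gcdA (f.map σ) (g.map σ), EuclideanDomain.gcdB (f.map σ) (g.map σ),
      mul_left_cancel₀ hG0 ?_⟩
    rw [← hG] at hbez
    linear_combination -hbez - EuclideanDomain.gcdA (f.map σ) (g.map σ) * ha
      - EuclideanDomain.gcdB (f.map σ) (g.map σ) * hb
  have hWG : U * f.map σ + V * g.map σ = 0 := by
    refine eq_zero_of_dvd_of_degree_lt (p := G) ?_ (by rwa [degree_eq_natDegree hG0])
    exact dvd_add (Dvd.dvd.mul_left ⟨a, ha⟩ _) (Dvd.dvd.mul_left ⟨b, hb⟩ _)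
  have hUV : U * a + V * b = 0 := by
    refine mul_left_cancel₀ hG0 ?_
    linear_combination hWG - U * ha - V * hb
  rcases hlc with hc | hc
  · have hdeg := natDegree_map_of_leadingCoeff_ne_zero σ hc
    have ha0 : a ≠ 0 := by
      rintro rfl
      rw [mul_zero] at ha
      rw [ha, natDegree_zero] at hdeg
      omega
    rw [ha, natDegree_mul hG0 ha0] at hdeg
    obtain ⟨rfl, rfl⟩ := eq_zero_of_mul_add_mul_eq_zero hab ha0 hUV
      (by rw [degree_eq_natDegree ha0]; exact hV.trans_le (by exact_mod_cast (by omega)))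
    simp at hne
  · have hdeg := natDegree_map_of_leadingCoeff_ne_zero σ hc
    have hb0 : b ≠ 0 := by
      rintro rfl
      rw [mul_zero] at hb
      rw [hb, natDegree_zero] at hdeg
      omega
    rw [hb, natDegree_mul hG0 hb0] at hdeg
    obtain ⟨rfl, rfl⟩ := eq_zero_of_mul_add_mul_eq_zero (U := V) (V := U) hab.symm hb0
      (by linear_combination hUV)
      (by rw [degree_eq_natDegree hb0]; exact hU.trans_le (by exact_mod_cast (by omega)))
    simp at hne

end Subresultants

/-! ### The regular subchain under specialisation -/

section RegularSubchain

variable {R : Type*} [CommRing R] {K : Type*} [Field K]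

open scoped Classical in
/-- The indices of the regular entries of the subresultant chain, in decreasing order. -/
noncomputable def regularIndices (f g : R[X]) : List ℕ :=
  (List.range (chainTop f g + 1)).reverse.filter
    fun j => (subresultantChain f g j).degree = (j : WithBot ℕ)

theorem srs_eq_map_regularIndices (f g : R[X]) :
    srs f g = (regularIndices f g).map (subresultantChain f g) := rfl

theorem pairwise_regularIndices (f g : R[X]) : (regularIndices f g).Pairwise (· > ·) := by
  refine List.Pairwise.filter _ ?_
  rw [List.pairwise_reverse]
  exact List.pairwise_lt_range

theorem degree_of_mem_regularIndices {f g : R[X]} {j : ℕ} (hj : j ∈ regularIndices f g) :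
    (subresultantChain f g j).degree = j := by
  simpa using (List.mem_filter.mp hj).2

theorem natDegree_le_chainTop {f g : R[X]} : g.natDegree ≤ chainTop f g := by
  unfold chainTop
  split_ifs <;> omega

theorem subresultantChain_of_lt {f g : R[X]} {j : ℕ} (hj : j < g.natDegree) :
    subresultantChain f g j = subresultant f g j := by
  have := natDegree_le_chainTop (f := f) (g := g)
  rw [subresultantChain, if_neg (by omega), if_pos hj]

theorem subresultantChain_natDegree (f g : R[X]) :
    ∃ e : ℕ, subresultantChain f g g.natDegree = C g.leadingCoeff ^ e * g := by
  unfold subresultantChain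
  by_cases h : g.natDegree = chainTop f g
  · exact ⟨0, by simp [← h]⟩
  · exact ⟨f.natDegree - g.natDegree - 1, by simp [h]⟩

theorem le_natDegree_of_mem_regularIndices {f g : R[X]} (hg : g ≠ 0) {j : ℕ}
    (hj : j ∈ regularIndices f g) : j ≤ g.natDegree := by
  have hd := degree_of_mem_regularIndices hj
  unfold subresultantChain at hd
  split_ifs at hd with h1 h2 h3
  · rw [degree_eq_natDegree hg] at hd
    exact (Nat.cast_injective hd).ge
  · exact h2.le
  · exact h3.le
  · simp at hd

theorem mem_regularIndices_of_det_ne_zero {f g : R[X]} {j : ℕ} (hj : j < g.natDegree)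
    (h : (sylvesterMinor f g j j).det ≠ 0) : j ∈ regularIndices f g := by
  have := natDegree_le_chainTop (f := f) (g := g)
  refine List.mem_filter.mpr ⟨by simp; omega, ?_⟩
  rw [subresultantChain_of_lt hj]
  simpa using (subresultant_degree_eq_iff f g j).mpr h

theorem leadingCoeff_subresultantChain {f g : R[X]} {j : ℕ} (hj : j < g.natDegree)
    (h : j ∈ regularIndices f g) :
    (subresultantChain f g j).leadingCoeff = (sylvesterMinor f g j j).det := by
  have hd := natDegree_eq_of_degree_eq_some (degree_of_mem_regularIndices h)
  rw [leadingCoeff, hd, subresultantChain_of_lt hj, subresultant_coeff_self]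

theorem natDegree_mem_regularIndices [IsDomain R] {f g : R[X]} (hg : g ≠ 0) :
    g.natDegree ∈ regularIndices f g := by
  have := natDegree_le_chainTop (f := f) (g := g)
  refine List.mem_filter.mpr ⟨by simp; omega, ?_⟩
  obtain ⟨e, he⟩ := subresultantChain_natDegree f g
  have hC : (C g.leadingCoeff ^ e : R[X]).degree = 0 := by
    rw [← C_pow, degree_C (pow_ne_zero _ (leadingCoeff_ne_zero.mpr hg))]
  rw [he, degree_mul, hC, zero_add, degree_eq_natDegree hg]
  simp

theorem subresultantChain_mem_span {f g : R[X]} (hg : g ≠ 0) (hgf : g.natDegree ≤ f.natDegree)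
    {j : ℕ} (hj : j ∈ regularIndices f g) :
    subresultantChain f g j ∈ Ideal.span {f, g} := by
  rcases (le_natDegree_of_mem_regularIndices hg hj).lt_or_eq with h | rfl
  · rw [subresultantChain_of_lt h]
    exact subresultant_mem_span h hgf
  · obtain ⟨e, he⟩ := subresultantChain_natDegree f g
    rw [he]
    exact Ideal.mul_mem_left _ _ (Ideal.subset_span (by simp))

theorem map_det_eq_zero_of_regular {f g : R[X]} (σ : R →+* K) {k : ℕ} (hk : k ≤ g.natDegree)
    (h : ∀ j ∈ regularIndices f g, j < k → σ (subresultantChain f g j).leadingCoeff = 0) :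
    ∀ j < k, σ (sylvesterMinor f g j j).det = 0 := by
  intro j hj
  by_cases hd : (sylvesterMinor f g j j).det = 0
  · rw [hd, map_zero]
  · have hm := mem_regularIndices_of_det_ne_zero (hj.trans_le hk) hd
    rw [← leadingCoeff_subresultantChain (hj.trans_le hk) hm]
    exact h j hm hj

theorem map_dvd_of_mem_span {f g h : R[X]} (hh : h ∈ Ideal.span {f, g}) (σ : R →+* K) {d : K[X]}
    (hf : d ∣ f.map σ) (hg : d ∣ g.map σ) : d ∣ h.map σ := by
  obtain ⟨u, v, rfl⟩ := Ideal.mem_span_pair.mp hh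
  rw [Polynomial.map_add, Polynomial.map_mul, Polynomial.map_mul]
  exact dvd_add (hf.mul_left _) (hg.mul_left _)

/-- The lowest regular entry that keeps its degree under a specialisation specialises to a common
divisor: it lies in the ideal of `f` and `g`, so their gcd divides it, and by the vanishing of the
lower principal minors the degree of the gcd is at least its own. -/
theorem map_subresultantChain_dvd [IsDomain R] {f g : R[X]} (hg : g ≠ 0)
    (hgf : g.natDegree ≤ f.natDegree) (σ : R →+* K)
    (hlc : σ f.leadingCoeff ≠ 0 ∨ σ g.leadingCoeff ≠ 0) {k : ℕ} (hk : k ∈ regularIndices f g)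
    (hσ : σ (subresultantChain f g k).leadingCoeff ≠ 0)
    (h : ∀ j ∈ regularIndices f g, j < k → σ (subresultantChain f g j).leadingCoeff = 0) :
    (subresultantChain f g k).map σ ∣ f.map σ ∧ (subresultantChain f g k).map σ ∣ g.map σ := by
  classical
  have hkg := le_natDegree_of_mem_regularIndices hg hk
  have hle := le_natDegree_gcd_map hgf σ hlc hkg (map_det_eq_zero_of_regular σ hkg h)
  set G := EuclideanDomain.gcd (f.map σ) (g.map σ) with hG
  have hGf : G ∣ f.map σ := EuclideanDomain.gcd_dvd_left _ _
  have hGg : G ∣ g.map σ := EuclideanDomain.gcd_dvd_right _ _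
  have hGS := map_dvd_of_mem_span (subresultantChain_mem_span hg hgf hk) σ hGf hGg
  have hdeg : ((subresultantChain f g k).map σ).natDegree = k :=
    (natDegree_map_of_leadingCoeff_ne_zero σ hσ).trans
      (natDegree_eq_of_degree_eq_some (degree_of_mem_regularIndices hk))
  have hS0 : (subresultantChain f g k).map σ ≠ 0 := by
    intro h0
    refine hσ ?_
    simpa using congrArg (fun p => coeff p (subresultantChain f g k).natDegree) h0
  have hassoc : (subresultantChain f g k).map σ ∣ G :=
    (associated_of_dvd_of_natDegree_le hGS hS0 (by rw [hdeg]; exact hle)).dvd'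
  exact ⟨hassoc.trans hGf, hassoc.trans hGg⟩

theorem map_eq_zero_of_regular [IsDomain R] {f g : R[X]} (hg : 0 < g.natDegree)
    (hgf : g.natDegree ≤ f.natDegree) (σ : R →+* K)
    (hlc : σ f.leadingCoeff ≠ 0 ∨ σ g.leadingCoeff ≠ 0)
    (h : ∀ j ∈ regularIndices f g, σ (subresultantChain f g j).leadingCoeff = 0) :
    g.map σ = 0 := by
  classical
  have hg0 : g ≠ 0 := ne_zero_of_natDegree_gt hg
  have hle := le_natDegree_gcd_map hgf σ hlc le_rfl
    (map_det_eq_zero_of_regular σ le_rfl fun j hj _ => h j hj)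
  have hlg : σ g.leadingCoeff = 0 := by
    obtain ⟨e, he⟩ := subresultantChain_natDegree f g
    have := h _ (natDegree_mem_regularIndices hg0)
    rw [he, leadingCoeff_mul, ← C_pow, leadingCoeff_C, map_mul, map_pow, ← pow_succ] at this
    exact eq_zero_of_pow_eq_zero this
  by_contra hne
  have h1 := natDegree_le_of_dvd (EuclideanDomain.gcd_dvd_right (f.map σ) (g.map σ)) hne
  have h2 : (g.map σ).degree < g.natDegree := by
    rw [degree_lt_iff_coeff_zero]
    intro m hm
    rw [coeff_map]
    rcases hm.lt_or_eq with hm | rfl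
    · rw [coeff_eq_zero_of_natDegree_lt hm, map_zero]
    · exact hlg
  rw [degree_eq_natDegree hne] at h2
  have := Nat.cast_lt.mp h2
  omega

/-- The properties of the subresultant regular subchain `H` of two polynomials that do not depend on
a specialisation; they are symmetric in the two polynomials. -/
structure IsRegularSubchain (q p : R[X]) (H : List R[X]) : Prop where
  length_pos : 0 < H.length
  ne_zero : ∀ i < H.length, H.getD i 0 ≠ 0
  natDegree_le_left : ∀ i < H.length, (H.getD i 0).natDegree ≤ q.natDegree
  natDegree_le_right : ∀ i < H.length, (H.getD i 0).natDegree ≤ p.natDegree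
  natDegree_head : 0 < (H.getD 0 0).natDegree
  natDegree_lt : ∀ i k, i < k → k < H.length → (H.getD k 0).natDegree < (H.getD i 0).natDegree
  mem_span : ∀ i < H.length, H.getD i 0 ∈ Ideal.span {q, p}

theorem IsRegularSubchain.symm {q p : R[X]} {H : List R[X]} (h : IsRegularSubchain q p H) :
    IsRegularSubchain p q H :=
  { h with
    natDegree_le_left := h.natDegree_le_right
    natDegree_le_right := h.natDegree_le_left
    mem_span := fun i hi => by rw [Set.pair_comm]; exact h.mem_span i hi }

theorem srs_getD {f g : R[X]} {i : ℕ} (hi : i < (regularIndices f g).length) :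
    (srs f g).getD i 0 = subresultantChain f g (regularIndices f g)[i] := by
  rw [srs_eq_map_regularIndices, List.getD_eq_getElem _ _ (by simpa using hi), List.getElem_map]

theorem length_srs (f g : R[X]) : (srs f g).length = (regularIndices f g).length := by
  rw [srs_eq_map_regularIndices, List.length_map]

theorem natDegree_srs_getD {f g : R[X]} {i : ℕ} (hi : i < (regularIndices f g).length) :
    ((srs f g).getD i 0).natDegree = (regularIndices f g)[i] := by
  rw [srs_getD hi]
  exact natDegree_eq_of_degree_eq_some (degree_of_mem_regularIndices (List.getElem_mem hi))

theorem isRegularSubchain_srs [IsDomain R] {f g : R[X]} (hg : 0 < g.natDegree)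
    (hgf : g.natDegree ≤ f.natDegree) : IsRegularSubchain f g (srs f g) := by
  have hg0 : g ≠ 0 := ne_zero_of_natDegree_gt hg
  have hJ := List.pairwise_iff_getElem.mp (pairwise_regularIndices f g)
  have hle : ∀ i (hi : i < (regularIndices f g).length), (regularIndices f g)[i] ≤ g.natDegree :=
    fun i hi => le_natDegree_of_mem_regularIndices hg0 (List.getElem_mem hi)
  obtain ⟨i₀, hi₀, h₀⟩ := List.mem_iff_getElem.mp (natDegree_mem_regularIndices (f := f) hg0)
  refine ⟨?_, ?_, ?_, ?_, ?_, ?_, ?_⟩ <;> try rw [length_srs]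
  · omega
  · intro i hi h
    rw [srs_getD hi] at h
    have := degree_of_mem_regularIndices (List.getElem_mem hi)
    simp [h] at this
  · intro i hi
    rw [natDegree_srs_getD hi]
    exact (hle i hi).trans hgf
  · intro i hi
    rw [natDegree_srs_getD hi]
    exact hle i hi
  · rw [natDegree_srs_getD (by omega)]
    rcases Nat.eq_zero_or_pos i₀ with rfl | hpos
    · omega
    · have := hJ 0 i₀ (by omega) hi₀ hpos
      omega
  · intro i k hik hk
    rw [natDegree_srs_getD hk, natDegree_srs_getD (hik.trans hk)]
    exact hJ i k (hik.trans hk) hk hik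
  · intro i hi
    rw [srs_getD hi]
    exact subresultantChain_mem_span hg0 hgf (List.getElem_mem hi)

theorem isRegularSubchain_srsOrdered [IsDomain R] {q p : R[X]} (hq : 0 < q.natDegree)
    (hp : 0 < p.natDegree) : IsRegularSubchain q p (srsOrdered q p) := by
  unfold srsOrdered
  split_ifs with h
  · exact isRegularSubchain_srs hp h
  · exact (isRegularSubchain_srs hq (not_le.mp h).le).symm

theorem map_srs_dvd [IsDomain R] {f g : R[X]} (hg : 0 < g.natDegree)
    (hgf : g.natDegree ≤ f.natDegree) (σ : R →+* K)
    (hlc : σ f.leadingCoeff ≠ 0 ∨ σ g.leadingCoeff ≠ 0) {i : ℕ} (hi : i < (srs f g).length)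
    (hσ : σ ((srs f g).getD i 0).leadingCoeff ≠ 0)
    (h : ∀ k, i < k → k < (srs f g).length → σ ((srs f g).getD k 0).leadingCoeff = 0) :
    ((srs f g).getD i 0).map σ ∣ f.map σ ∧ ((srs f g).getD i 0).map σ ∣ g.map σ := by
  have hJ := List.pairwise_iff_getElem.mp (pairwise_regularIndices f g)
  rw [length_srs] at hi h
  rw [srs_getD hi] at hσ ⊢
  refine map_subresultantChain_dvd (ne_zero_of_natDegree_gt hg) hgf σ hlc (List.getElem_mem hi) hσ ?_
  intro j hj hlt
  obtain ⟨k, hk, rfl⟩ := List.mem_iff_getElem.mp hj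
  have hik : i < k := by
    by_contra! hle
    rcases hle.lt_or_eq with h | rfl
    · exact absurd (hJ k i hk hi h) (by omega)
    · omega
  have := h k hik hk
  rwa [srs_getD hk] at this

theorem map_eq_zero_of_srs [IsDomain R] {f g : R[X]} (hg : 0 < g.natDegree)
    (hgf : g.natDegree ≤ f.natDegree) (σ : R →+* K)
    (hlc : σ f.leadingCoeff ≠ 0 ∨ σ g.leadingCoeff ≠ 0)
    (h : ∀ k < (srs f g).length, σ ((srs f g).getD k 0).leadingCoeff = 0) :
    g.map σ = 0 := by
  refine map_eq_zero_of_regular hg hgf σ hlc fun j hj => ?_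
  obtain ⟨k, hk, rfl⟩ := List.mem_iff_getElem.mp hj
  rw [← srs_getD hk]
  exact h k (by rwa [length_srs])

theorem map_srsOrdered_dvd [IsDomain R] {q p : R[X]} (hq : 0 < q.natDegree)
    (hp : 0 < p.natDegree) (σ : R →+* K) (hlc : σ p.leadingCoeff ≠ 0)
    {i : ℕ} (hi : i < (srsOrdered q p).length)
    (hσ : σ ((srsOrdered q p).getD i 0).leadingCoeff ≠ 0)
    (h : ∀ k, i < k → k < (srsOrdered q p).length →
      σ ((srsOrdered q p).getD k 0).leadingCoeff = 0) :
    ((srsOrdered q p).getD i 0).map σ ∣ q.map σ ∧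
      ((srsOrdered q p).getD i 0).map σ ∣ p.map σ := by
  unfold srsOrdered at *
  split_ifs at * with hqp
  · exact map_srs_dvd hp hqp σ (Or.inr hlc) hi hσ h
  · exact (map_srs_dvd hq (not_le.mp hqp).le σ (Or.inl hlc) hi hσ h).symm

/-- If all regular entries lose their degree although `p` keeps its own, then `q` is the polynomial
of lower degree, and it vanishes under the specialisation. -/
theorem map_eq_zero_of_srsOrdered [IsDomain R] {q p : R[X]} (hq : 0 < q.natDegree)
    (hp : 0 < p.natDegree) (σ : R →+* K) (hlc : σ p.leadingCoeff ≠ 0)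
    (h : ∀ k < (srsOrdered q p).length, σ ((srsOrdered q p).getD k 0).leadingCoeff = 0) :
    q.natDegree < p.natDegree ∧ q.map σ = 0 := by
  unfold srsOrdered at h
  split_ifs at h with hqp
  · have h0 := map_eq_zero_of_srs hp hqp σ (Or.inr hlc) h
    refine absurd ?_ hlc
    simpa using congrArg (fun u => coeff u p.natDegree) h0
  · exact ⟨not_le.mp hqp, map_eq_zero_of_srs hq (not_le.mp hqp).le σ (Or.inl hlc) h⟩

/-! ### Pseudo-division under specialisation -/

/-- If `h` keeps its degree and divides the specialisation of `p`, then the pseudo-division of `p` by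
`h` specialises to an exact division up to a unit. -/
theorem map_pquo_mul {p h : R[X]} (σ : R →+* K) (hlc : σ h.leadingCoeff ≠ 0)
    (hdvd : h.map σ ∣ p.map σ) :
    C (σ h.leadingCoeff) ^ (p.natDegree + 1 - h.natDegree) * p.map σ
      = (pquo p h).map σ * h.map σ := by
  have h0 : h ≠ 0 := by rintro rfl; simp at hlc
  obtain ⟨r, hr, hdeg⟩ := pquo_spec p h h0
  have hr' := congrArg (Polynomial.map σ) hr
  simp only [Polynomial.map_mul, Polynomial.map_add, Polynomial.map_pow, map_C] at hr'
  have hr0 : r.map σ = 0 := by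
    refine eq_zero_of_dvd_of_degree_lt (p := h.map σ) ?_ ?_
    · rw [← dvd_add_right (Dvd.intro_left _ rfl), ← hr']
      exact hdvd.mul_left _
    · rw [degree_map_eq_of_leadingCoeff_ne_zero σ hlc]
      exact degree_map_le.trans_lt hdeg
  rw [hr', hr0, add_zero]

theorem natDegree_pquo_le [IsDomain R] {p h : R[X]} (h0 : h ≠ 0) :
    (pquo p h).natDegree ≤ p.natDegree - h.natDegree := by
  by_cases ho : pquo p h = 0
  · simp [ho]
  obtain ⟨r, hr, hdeg⟩ := pquo_spec p h h0
  have hlt : r.degree < (pquo p h * h).degree := by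
    refine hdeg.trans_le ?_
    rw [mul_comm]
    exact degree_le_mul_left _ ho
  have h1 := degree_add_eq_left_of_degree_lt hlt
  rw [← hr, ← C_pow] at h1
  have h2 := natDegree_eq_of_degree_eq h1
  rw [natDegree_C_mul (pow_ne_zero _ (leadingCoeff_ne_zero.mpr h0)), natDegree_mul ho h0] at h2
  omega

end RegularSubchain

namespace PReg

variable {F : Type*} [Field F] {n : ℕ}

/-! ### Zeros of systems in the main variable -/

/-- Evaluation at the point `(ξ, β)`, where `β` is the value of the main variable. -/
noncomputable def evalAt (ξ : Fin n → F) (β : F) : (MvPolynomial (Fin n) F)[X] →+* F :=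
  eval₂RingHom (MvPolynomial.eval ξ) β

/-- The point `(ξ, β)` is a zero of the system. -/
def IsZero (ξ : Fin n → F) (β : F) (A : PolySystem (MvPolynomial (Fin n) F)[X]) : Prop :=
  (∀ p ∈ A.eqs, evalAt ξ β p = 0) ∧ ∀ q ∈ A.neqs, evalAt ξ β q ≠ 0

theorem evalAt_eq_eval_map (ξ : Fin n → F) (β : F) (p : (MvPolynomial (Fin n) F)[X]) :
    evalAt ξ β p = (p.map (MvPolynomial.eval ξ)).eval β := by
  simp [evalAt, eval₂_eq_eval_map]

@[simp]
theorem evalAt_C (ξ : Fin n → F) (β : F) (c : MvPolynomial (Fin n) F) :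
    evalAt ξ β (C c) = MvPolynomial.eval ξ c := by
  simp [evalAt]

theorem evalAt_of_natDegree_eq_zero (ξ : Fin n → F) (β : F) {p : (MvPolynomial (Fin n) F)[X]}
    (hp : p.natDegree = 0) : evalAt ξ β p = MvPolynomial.eval ξ (p.coeff 0) := by
  conv_lhs => rw [eq_C_of_natDegree_eq_zero hp, evalAt_C]

theorem evalAt_of_natDegree_eq_zero' (ξ : Fin n → F) (β : F) {p : (MvPolynomial (Fin n) F)[X]}
    (hp : p.natDegree = 0) : evalAt ξ β p = MvPolynomial.eval ξ p.leadingCoeff := by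
  rw [evalAt_of_natDegree_eq_zero ξ β hp, leadingCoeff, hp]

theorem evalAt_eq_zero_of_dvd {ξ : Fin n → F} {β : F} {h p : (MvPolynomial (Fin n) F)[X]}
    (hd : h.map (MvPolynomial.eval ξ) ∣ p.map (MvPolynomial.eval ξ)) (h0 : evalAt ξ β h = 0) :
    evalAt ξ β p = 0 := by
  rw [evalAt_eq_eval_map] at h0 ⊢
  exact eval_eq_zero_of_dvd_of_eval_eq_zero hd h0

theorem evalAt_eq_zero_of_mem_span {ξ : Fin n → F} {β : F} {h p q : (MvPolynomial (Fin n) F)[X]}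
    (hh : h ∈ Ideal.span {q, p}) (hq : evalAt ξ β q = 0) (hp : evalAt ξ β p = 0) :
    evalAt ξ β h = 0 := by
  obtain ⟨u, v, rfl⟩ := Ideal.mem_span_pair.mp hh
  simp [hq, hp]

theorem evalAt_eraseLead {ξ : Fin n → F} (β : F) {p : (MvPolynomial (Fin n) F)[X]}
    (h : MvPolynomial.eval ξ p.leadingCoeff = 0) : evalAt ξ β p.eraseLead = evalAt ξ β p := by
  conv_rhs => rw [← eraseLead_add_C_mul_X_pow p, map_add, map_mul, evalAt_C, h]
  simp

section

variable [DecidableEq (MvPolynomial (Fin n) F)[X]]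

theorem isZero_insert_eqs {ξ : Fin n → F} {β : F} {p : (MvPolynomial (Fin n) F)[X]}
    {P Q : Finset (MvPolynomial (Fin n) F)[X]} :
    IsZero ξ β ⟨insert p P, Q⟩ ↔ evalAt ξ β p = 0 ∧ IsZero ξ β ⟨P, Q⟩ := by
  simp [IsZero, and_assoc]

theorem isZero_insert_neqs {ξ : Fin n → F} {β : F} {q : (MvPolynomial (Fin n) F)[X]}
    {P Q : Finset (MvPolynomial (Fin n) F)[X]} :
    IsZero ξ β ⟨P, insert q Q⟩ ↔ evalAt ξ β q ≠ 0 ∧ IsZero ξ β ⟨P, Q⟩ := by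
  simp [IsZero]
  tauto

theorem isZero_union_eqs {ξ : Fin n → F} {β : F}
    {P L Q : Finset (MvPolynomial (Fin n) F)[X]} :
    IsZero ξ β ⟨P ∪ L, Q⟩ ↔ (∀ l ∈ L, evalAt ξ β l = 0) ∧ IsZero ξ β ⟨P, Q⟩ := by
  simp [IsZero, or_imp, forall_and]
  tauto

theorem isZero_erase_eqs {ξ : Fin n → F} {β : F} {p : (MvPolynomial (Fin n) F)[X]}
    {P Q : Finset (MvPolynomial (Fin n) F)[X]} (hp : p ∈ P) :
    IsZero ξ β ⟨P, Q⟩ ↔ evalAt ξ β p = 0 ∧ IsZero ξ β ⟨P.erase p, Q⟩ := by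
  rw [← isZero_insert_eqs, Finset.insert_erase hp]

theorem isZero_erase_neqs {ξ : Fin n → F} {β : F} {q : (MvPolynomial (Fin n) F)[X]}
    {P Q : Finset (MvPolynomial (Fin n) F)[X]} (hq : q ∈ Q) :
    IsZero ξ β ⟨P, Q⟩ ↔ evalAt ξ β q ≠ 0 ∧ IsZero ξ β ⟨P, Q.erase q⟩ := by
  rw [← isZero_insert_neqs, Finset.insert_erase hq]

end

theorem forall_lcs_drop {ξ : Fin n → F} {β : F} {H : List (MvPolynomial (Fin n) F)[X]} {i : ℕ} :
    (∀ l ∈ lcs (H.drop (i + 1)), evalAt ξ β l = 0) ↔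
      ∀ k, i < k → k < H.length → MvPolynomial.eval ξ (H.getD k 0).leadingCoeff = 0 := by
  simp only [lcs, List.mem_toFinset, List.mem_map, forall_exists_index, and_imp,
    forall_apply_eq_imp_iff₂, evalAt_C]
  constructor
  · intro h k hik hk
    rw [List.getD_eq_getElem _ _ hk]
    exact h _ (List.mem_drop_iff_getElem.mpr ⟨k - (i + 1), by omega, by congr 1; omega⟩)
  · intro h a ha
    obtain ⟨k, hk, rfl⟩ := List.mem_drop_iff_getElem.mp ha
    have := h (i + 1 + k) (by omega) (by omega)
    rwa [List.getD_eq_getElem _ _ (by omega)] at this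

/-! ### Points excluded by the system and the single-polynomial projection -/

open scoped Classical in
/-- A point over which `a` differs from `a` over `α` is covered by the single-polynomial
projection of `a`. -/
theorem exists_mem_projCoeffCalls {α ξ : Fin n → F} {β : F}
    {P Q : Finset (MvPolynomial (Fin n) F)[X]} {a : (MvPolynomial (Fin n) F)[X]}
    (hz : IsZero ξ β ⟨P, Q⟩) (h : evalAt α β a ≠ evalAt ξ β a) :
    ∃ B ∈ projCoeffCalls α P Q a, IsZero ξ β B := by
  obtain ⟨d, hd⟩ : ∃ d, MvPolynomial.eval ξ (a.coeff d) ≠ MvPolynomial.eval α (a.coeff d) := by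
    by_contra! hc
    refine h ?_
    rw [evalAt_eq_eval_map, evalAt_eq_eval_map]
    congr 1
    ext d
    rw [coeff_map, coeff_map, hc d]
  have hs : d ∈ a.support := by
    rw [mem_support_iff]
    intro h0
    simp [h0] at hd
  refine ⟨_, Finset.mem_image_of_mem _ (Finset.mem_image_of_mem _ hs), ?_⟩
  refine ⟨hz.1, fun q hq => ?_⟩
  rcases Finset.mem_insert.mp hq with rfl | hq
  · rw [evalAt_C]
    simpa [sub_eq_zero] using hd
  · exact hz.2 q hq

open scoped Classical in
theorem excludesNeq_of_mem_projCoeffCalls {α : Fin n → F}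
    {P Q : Finset (MvPolynomial (Fin n) F)[X]} {a : (MvPolynomial (Fin n) F)[X]}
    {B : PolySystem (MvPolynomial (Fin n) F)[X]} (hB : B ∈ projCoeffCalls α P Q a) :
    ∃ u, ExcludesNeq α B u := by
  obtain ⟨u, hu, rfl⟩ := Finset.mem_image.mp hB
  obtain ⟨d, -, rfl⟩ := Finset.mem_image.mp hu
  exact ⟨_, Finset.mem_insert_self _ _, natDegree_C _, by simp⟩

theorem ExcludesEq.not_isZero {α : Fin n → F} {A : PolySystem (MvPolynomial (Fin n) F)[X]}
    {u : (MvPolynomial (Fin n) F)[X]} (h : ExcludesEq α A u) (β : F) : ¬ IsZero α β A := by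
  intro hz
  have := hz.1 u h.1
  rw [evalAt_of_natDegree_eq_zero α β h.2.1] at this
  exact h.2.2 this

theorem ExcludesNeq.not_isZero {α : Fin n → F} {A : PolySystem (MvPolynomial (Fin n) F)[X]}
    {u : (MvPolynomial (Fin n) F)[X]} (h : ExcludesNeq α A u) (β : F) : ¬ IsZero α β A := by
  intro hz
  have := hz.2 u h.1
  rw [evalAt_of_natDegree_eq_zero α β h.2.1] at this
  exact this h.2.2

theorem mem_hat {P : Finset (MvPolynomial (Fin n) F)[X]} {p : (MvPolynomial (Fin n) F)[X]} :
    p ∈ hat P ↔ p ∈ P ∧ 0 < p.natDegree := by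
  simp [hat]

/-- If no polynomial free of the main variable excludes `α`, then only the other polynomials have to
be examined. -/
theorem isZero_of_hat {α : Fin n → F} {β : F} {A : PolySystem (MvPolynomial (Fin n) F)[X]}
    (hE : ∀ u, ¬ ExcludesEq α A u) (hN : ∀ u, ¬ ExcludesNeq α A u)
    (hP : ∀ p ∈ hat A.eqs, evalAt α β p = 0) (hQ : ∀ q ∈ hat A.neqs, evalAt α β q ≠ 0) :
    IsZero α β A := by
  constructor
  · intro p hp
    rcases Nat.eq_zero_or_pos p.natDegree with h | h
    · rw [evalAt_of_natDegree_eq_zero α β h]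
      exact not_not.mp fun h0 => hE p ⟨hp, h, h0⟩
    · exact hP p (mem_hat.mpr ⟨hp, h⟩)
  · intro q hq
    rcases Nat.eq_zero_or_pos q.natDegree with h | h
    · rw [evalAt_of_natDegree_eq_zero α β h]
      exact fun h0 => hN q ⟨hq, h, h0⟩
    · exact hQ q (mem_hat.mpr ⟨hq, h⟩)

/-! ### Sequences of guarded calls -/

/-- A guarded sequence is sound for `A` on the set of points `S`: at each point, a guard that is
reached and holds leads to a system with the same zeros above this point as `A`, and the zeros above
a point at which all guards fail are covered by the systems in `last`. -/
def GuardsSound (A : PolySystem (MvPolynomial (Fin n) F)[X])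
    (last : Finset (PolySystem (MvPolynomial (Fin n) F)[X])) :
    ((Fin n → F) → Prop) →
      List (PolyConstraint (MvPolynomial (Fin n) F) × PolySystem (MvPolynomial (Fin n) F)[X]) → Prop
  | S, [] => ∀ ξ β, S ξ → IsZero ξ β A → ∃ B ∈ last, IsZero ξ β B
  | S, (c, B) :: G => (∀ ξ β, S ξ → c.HoldsAt ξ → (IsZero ξ β A ↔ IsZero ξ β B)) ∧
      GuardsSound A last (fun ξ => S ξ ∧ ¬ c.HoldsAt ξ) G

theorem mem_zeroq_toSystem {c : PolyConstraint (MvPolynomial (Fin n) F)} {ξ : Fin n → F} :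
    ξ ∈ zeroq c.toSystem ↔ c.HoldsAt ξ := by
  cases c <;> simp [zeroq, PolyConstraint.toSystem, PolyConstraint.HoldsAt]

theorem mem_zeroq_neg_toSystem {c : PolyConstraint (MvPolynomial (Fin n) F)} {ξ : Fin n → F} :
    ξ ∈ zeroq c.neg.toSystem ↔ ¬ c.HoldsAt ξ := by
  cases c <;>
    simp [zeroq, PolyConstraint.toSystem, PolyConstraint.neg, PolyConstraint.HoldsAt]

theorem notMem_zeroq_runGuards (α : Fin n → F)
    (last : Finset (PolySystem (MvPolynomial (Fin n) F)[X]))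
    (G : List (PolyConstraint (MvPolynomial (Fin n) F) ×
      PolySystem (MvPolynomial (Fin n) F)[X])) :
    ∀ D ∈ (runGuards α last G).1, α ∉ zeroq D := by
  classical
  induction G with
  | nil => simp [runGuards]
  | cons cB G ih =>
    obtain ⟨c, B⟩ := cB
    unfold runGuards
    split_ifs with hc
    · simp [mem_zeroq_neg_toSystem, hc]
    · intro D hD
      rcases Finset.mem_insert.mp hD with rfl | hD
      · rwa [mem_zeroq_toSystem]
      · exact ih D hD

theorem mem_runGuards_snd {α : Fin n → F} {last : Finset (PolySystem (MvPolynomial (Fin n) F)[X])}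
    {G : List (PolyConstraint (MvPolynomial (Fin n) F) × PolySystem (MvPolynomial (Fin n) F)[X])}
    {B : PolySystem (MvPolynomial (Fin n) F)[X]} (hB : B ∈ (runGuards α last G).2) :
    B ∈ last ∨ ∃ x ∈ G, x.2 = B := by
  induction G with
  | nil => exact Or.inl hB
  | cons cB G ih =>
    obtain ⟨c, B'⟩ := cB
    unfold runGuards at hB
    split_ifs at hB with hc
    · exact Or.inr ⟨_, List.mem_cons_self, (Finset.mem_singleton.mp hB).symm⟩
    · exact (ih hB).imp_right fun ⟨x, hx, h⟩ => ⟨x, List.mem_cons_of_mem _ hx, h⟩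

theorem GuardsSound.not_isZero {A : PolySystem (MvPolynomial (Fin n) F)[X]} {α : Fin n → F}
    (hA : ∀ β, ¬ IsZero α β A) {last : Finset (PolySystem (MvPolynomial (Fin n) F)[X])}
    (hlast : ∀ B ∈ last, ∀ β, ¬ IsZero α β B)
    {G : List (PolyConstraint (MvPolynomial (Fin n) F) × PolySystem (MvPolynomial (Fin n) F)[X])}
    {S : (Fin n → F) → Prop} (hS : S α) (hG : GuardsSound A last S G) :
    ∀ B ∈ (runGuards α last G).2, ∀ β, ¬ IsZero α β B := by
  induction G generalizing S with
  | nil => exact hlast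
  | cons cB G ih =>
    obtain ⟨c, B'⟩ := cB
    unfold runGuards
    split_ifs with hc
    · intro B hB β
      rw [Finset.mem_singleton.mp hB, ← hG.1 α β hS hc]
      exact hA β
    · exact ih ⟨hS, hc⟩ hG.2

/-- A point that is not covered by the tracked constraints passes through the same guards as `α`. -/
theorem GuardsSound.cover {A : PolySystem (MvPolynomial (Fin n) F)[X]} {α ξ : Fin n → F} {β : F}
    {last : Finset (PolySystem (MvPolynomial (Fin n) F)[X])}
    {G : List (PolyConstraint (MvPolynomial (Fin n) F) × PolySystem (MvPolynomial (Fin n) F)[X])}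
    {S : (Fin n → F) → Prop} (hS : S ξ) (hG : GuardsSound A last S G) (hz : IsZero ξ β A) :
    (∃ D ∈ (runGuards α last G).1, ξ ∈ zeroq D) ∨
      ∃ B ∈ (runGuards α last G).2, IsZero ξ β B := by
  classical
  induction G generalizing S with
  | nil => exact Or.inr (hG ξ β hS hz)
  | cons cB G ih =>
    obtain ⟨c, B'⟩ := cB
    unfold runGuards
    split_ifs with hc
    · by_cases hξ : c.HoldsAt ξ
      · exact Or.inr ⟨B', Finset.mem_singleton_self _, (hG.1 ξ β hS hξ).mp hz⟩
      · exact Or.inl ⟨_, Finset.mem_singleton_self _, mem_zeroq_neg_toSystem.mpr hξ⟩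
    · by_cases hξ : c.HoldsAt ξ
      · exact Or.inl ⟨_, Finset.mem_insert_self _ _, mem_zeroq_toSystem.mpr hξ⟩
      · exact (ih ⟨hS, hξ⟩ hG.2).imp_left
          fun ⟨D, hD, h⟩ => ⟨D, Finset.mem_insert_of_mem hD, h⟩

/-- Soundness of guards each of which is justified without its predecessors. -/
theorem guardsSound_of_forall {A : PolySystem (MvPolynomial (Fin n) F)[X]}
    {last : Finset (PolySystem (MvPolynomial (Fin n) F)[X])}
    {G : List (PolyConstraint (MvPolynomial (Fin n) F) × PolySystem (MvPolynomial (Fin n) F)[X])}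
    {S : (Fin n → F) → Prop}
    (hG : ∀ x ∈ G, ∀ ξ β, x.1.HoldsAt ξ → (IsZero ξ β A ↔ IsZero ξ β x.2))
    (hlast : ∀ ξ β, IsZero ξ β A → ∃ B ∈ last, IsZero ξ β B) : GuardsSound A last S G := by
  induction G generalizing S with
  | nil => exact fun ξ β _ => hlast ξ β
  | cons cB G ih =>
    exact ⟨fun ξ β _ => hG cB List.mem_cons_self ξ β,
      ih fun x hx => hG x (List.mem_cons_of_mem _ hx)⟩

/-- Soundness of a loop over the entries of a list, from the last position to the first. -/
theorem guardsSound_loop {A : PolySystem (MvPolynomial (Fin n) F)[X]}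
    {last : Finset (PolySystem (MvPolynomial (Fin n) F)[X])}
    (H : List (MvPolynomial (Fin n) F)[X]) (B : ℕ → PolySystem (MvPolynomial (Fin n) F)[X])
    (m : ℕ) {S : (Fin n → F) → Prop}
    (hstep : ∀ i < m, ∀ ξ β, S ξ → MvPolynomial.eval ξ (H.getD i 0).leadingCoeff ≠ 0 →
      (∀ k, i < k → k < m → MvPolynomial.eval ξ (H.getD k 0).leadingCoeff = 0) →
      (IsZero ξ β A ↔ IsZero ξ β (B i)))
    (hlast : ∀ ξ β, S ξ → (∀ k < m, MvPolynomial.eval ξ (H.getD k 0).leadingCoeff = 0) →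
      IsZero ξ β A → ∃ B ∈ last, IsZero ξ β B) :
    GuardsSound A last S ((List.range m).reverse.map fun i =>
      (PolyConstraint.neZero (H.getD i 0).leadingCoeff, B i)) := by
  induction m generalizing S with
  | zero => exact fun ξ β hS => hlast ξ β hS (by simp)
  | succ m ih =>
    rw [List.range_succ, List.reverse_append, List.reverse_singleton, List.singleton_append,
      List.map_cons]
    refine ⟨fun ξ β hS hc => hstep m (by omega) ξ β hS hc (by omega), ih ?_ ?_⟩
    · intro i hi ξ β hS hc hk
      refine hstep i (by omega) ξ β hS.1 hc fun k hik hkm => ?_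
      rcases (Nat.lt_succ_iff.mp hkm).lt_or_eq with h | rfl
      · exact hk k hik h
      · exact not_not.mp hS.2
    · intro ξ β hS hk
      refine hlast ξ β hS.1 fun k hkm => ?_
      rcases (Nat.lt_succ_iff.mp hkm).lt_or_eq with h | rfl
      · exact hk k h
      · exact not_not.mp hS.2

/-! ### Soundness of the single statements -/

section

open scoped Classical in
/-- The classical decision of equality of coefficients; the steps of the algorithm form their finite
sets with it. -/
@[reducible]
noncomputable local instance decidableEqCoeff : DecidableEq (MvPolynomial (Fin n) F) :=
  fun a b => Classical.propDecidable (a = b)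

theorem isZero_reductumGuard {P Q : Finset (MvPolynomial (Fin n) F)[X]}
    {p : (MvPolynomial (Fin n) F)[X]} (hp : p ∈ P) {ξ : Fin n → F} (β : F)
    (h : MvPolynomial.eval ξ p.leadingCoeff = 0) :
    IsZero ξ β ⟨P, Q⟩ ↔ IsZero ξ β (reductumGuard P Q p).2 := by
  rw [reductumGuard, isZero_insert_eqs, isZero_erase_eqs hp, evalAt_eraseLead β h]

theorem isZero_neqReductumGuard {P Q : Finset (MvPolynomial (Fin n) F)[X]}
    {q : (MvPolynomial (Fin n) F)[X]} (hq : q ∈ Q) {ξ : Fin n → F} (β : F)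
    (h : MvPolynomial.eval ξ q.leadingCoeff = 0) :
    IsZero ξ β ⟨P, Q⟩ ↔ IsZero ξ β (neqReductumGuard P Q q).2 := by
  rw [neqReductumGuard, isZero_insert_neqs, isZero_erase_neqs hq, evalAt_eraseLead β h]

theorem getLastD_eq_getD {M : Type*} (H : List M) (d : M) :
    H.getLastD d = H.getD (H.length - 1) d := by
  cases H using List.reverseRecOn with
  | nil => rfl
  | append_singleton H a => simp

/-- On a zero of `p` and `p'` the free entries of the subchain vanish; where they vanish and `p`
keeps its degree, the lowest entry that keeps its degree has exactly the common zeros. -/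
theorem evalAt_srsOrdered_eq_zero_iff {p p' : (MvPolynomial (Fin n) F)[X]} (hp : 0 < p.natDegree)
    (hp' : 0 < p'.natDegree) {ξ : Fin n → F} (β : F)
    (hlc : MvPolynomial.eval ξ p.leadingCoeff ≠ 0) {i : ℕ} (hi : i < (srsOrdered p' p).length)
    (hσ : MvPolynomial.eval ξ ((srsOrdered p' p).getD i 0).leadingCoeff ≠ 0)
    (h : ∀ k, i < k → k < (srsOrdered p' p).length →
      MvPolynomial.eval ξ ((srsOrdered p' p).getD k 0).leadingCoeff = 0 ∨
        ((srsOrdered p' p).getD k 0).natDegree = 0) :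
    evalAt ξ β p = 0 ∧ evalAt ξ β p' = 0 ↔
      evalAt ξ β ((srsOrdered p' p).getD i 0) = 0 ∧
        ∀ k, i < k → k < (srsOrdered p' p).length →
          MvPolynomial.eval ξ ((srsOrdered p' p).getD k 0).leadingCoeff = 0 := by
  have hH := isRegularSubchain_srsOrdered hp' hp
  constructor
  · rintro ⟨h1, h2⟩
    refine ⟨evalAt_eq_zero_of_mem_span (hH.mem_span i hi) h2 h1, fun k hik hk => ?_⟩
    rcases h k hik hk with h3 | h3
    · exact h3
    · rw [← evalAt_of_natDegree_eq_zero' ξ β h3]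
      exact evalAt_eq_zero_of_mem_span (hH.mem_span k hk) h2 h1
  · rintro ⟨h1, h2⟩
    obtain ⟨h3, h4⟩ := map_srsOrdered_dvd hp' hp (MvPolynomial.eval ξ) hlc hi hσ h2
    exact ⟨evalAt_eq_zero_of_dvd h4 h1, evalAt_eq_zero_of_dvd h3 h1⟩

theorem guardsSound_eqGuards {P Q : Finset (MvPolynomial (Fin n) F)[X]}
    {last : Finset (PolySystem (MvPolynomial (Fin n) F)[X])}
    {p p' : (MvPolynomial (Fin n) F)[X]} (hpP : p ∈ P) (hpP' : p' ∈ P) (hne : p' ≠ p)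
    (hp : 0 < p.natDegree) (hle : p.natDegree ≤ p'.natDegree) :
    GuardsSound ⟨P, Q⟩ last (fun ξ => MvPolynomial.eval ξ p.leadingCoeff ≠ 0)
      (eqGuards P Q p p') := by
  have hp' := hp.trans_le hle
  have hsrs : srs p' p = srsOrdered p' p := (if_pos hle).symm
  have hH := isRegularSubchain_srsOrdered hp' hp
  have hzero := @evalAt_srsOrdered_eq_zero_iff _ _ _ p p' hp hp'
  have hend := @map_eq_zero_of_srsOrdered _ _ F _ _ p' p hp' hp
  have hA : ∀ ξ β, IsZero ξ β ⟨P, Q⟩ ↔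
      (evalAt ξ β p = 0 ∧ evalAt ξ β p' = 0) ∧ IsZero ξ β ⟨(P.erase p).erase p', Q⟩ := by
    intro ξ β
    rw [isZero_erase_eqs hpP, isZero_erase_eqs (Finset.mem_erase.mpr ⟨hne, hpP'⟩), and_assoc]
  unfold eqGuards
  rw [hsrs]
  generalize srsOrdered p' p = H at *
  have hpos := hH.length_pos
  simp only [getLastD_eq_getD]
  split_ifs with hfree
  · -- `h_2` has positive degree, so a free `h_r` has a predecessor `h_{r-1}`
    have h2 : 2 ≤ H.length := by
      by_contra! h
      have := hH.natDegree_head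
      rw [show H.length - 1 = 0 by omega] at hfree
      omega
    refine ⟨?_, guardsSound_loop H _ _ ?_ ?_⟩
    · intro ξ β hlc hc
      rw [hA, isZero_insert_eqs, isZero_insert_eqs,
        hzero β hlc (i := H.length - 2) (by omega) hc fun k hk hk' => Or.inr (by
          rwa [show k = H.length - 1 by omega]), ← and_assoc]
      refine and_congr_left' ?_
      rw [evalAt_of_natDegree_eq_zero' ξ β hfree, and_comm]
      refine and_congr_left' ⟨fun h => h _ (by omega) (by omega), fun h k hk hk' => ?_⟩
      rwa [show k = H.length - 1 by omega]
    · -- `l_r` is not guarded here: it is an equation of the new system, and if `l_r` does not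
      -- vanish at `ξ`, then neither system has a zero above `ξ`
      rintro i hi ξ β ⟨hlc, hS⟩ hc hk
      rw [hA, isZero_insert_eqs, isZero_union_eqs, forall_lcs_drop,
        hzero β hlc (by omega) hc fun k hik hkl => ?_, and_assoc]
      by_cases h1 : k = H.length - 1
      · exact Or.inr (h1 ▸ hfree)
      by_cases h2 : k = H.length - 2
      · exact Or.inl (h2 ▸ not_not.mp hS)
      · exact Or.inl (hk k hik (by omega))
    · rintro ξ β ⟨hlc, hS⟩ hk hz
      obtain ⟨⟨h3, h4⟩, -⟩ := (hA ξ β).mp hz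
      refine absurd (hend (MvPolynomial.eval ξ) hlc fun k hkl => ?_).1 (by omega)
      by_cases h1 : k = H.length - 1
      · rw [h1, ← evalAt_of_natDegree_eq_zero' ξ β hfree]
        exact evalAt_eq_zero_of_mem_span (hH.mem_span _ (by omega)) h4 h3
      by_cases h2 : k = H.length - 2
      · exact h2 ▸ not_not.mp hS
      · exact hk k (by omega)
  · refine guardsSound_loop H _ _ ?_ ?_
    · intro i hi ξ β hlc hc hk
      rw [hA, isZero_insert_eqs, isZero_union_eqs, forall_lcs_drop,
        hzero β hlc hi hc fun k hik hkl => Or.inl (hk k hik hkl), and_assoc]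
    · intro ξ β hlc hk
      exact absurd (hend (MvPolynomial.eval ξ) hlc hk).1 (by omega)

/-- Where `p` is divided by an entry `h` that specialises to a divisor of `p` and `q`, only those
zeros of `p` are lost at which `q` vanishes. -/
theorem evalAt_pquo_eq_zero_iff {p h : (MvPolynomial (Fin n) F)[X]} {ξ : Fin n → F} {β : F}
    (hσ : MvPolynomial.eval ξ h.leadingCoeff ≠ 0)
    (hdvd : h.map (MvPolynomial.eval ξ) ∣ p.map (MvPolynomial.eval ξ))
    (hh : evalAt ξ β h ≠ 0) : evalAt ξ β p = 0 ↔ evalAt ξ β (pquo p h) = 0 := by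
  have := congrArg (Polynomial.eval β) (map_pquo_mul (MvPolynomial.eval ξ) hσ hdvd)
  simp only [eval_mul, eval_pow, eval_C, ← evalAt_eq_eval_map] at this
  constructor
  · intro h0
    rw [h0, mul_zero] at this
    exact (mul_eq_zero.mp this.symm).resolve_right hh
  · intro h0
    rw [h0, zero_mul] at this
    exact (mul_eq_zero.mp this).resolve_left (pow_ne_zero _ hσ)

theorem guardsSound_neqGuards {P Q : Finset (MvPolynomial (Fin n) F)[X]}
    {last : Finset (PolySystem (MvPolynomial (Fin n) F)[X])}
    {p q : (MvPolynomial (Fin n) F)[X]} (hpP : p ∈ P) (hqQ : q ∈ Q)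
    (hp : 0 < p.natDegree) (hq : 0 < q.natDegree) :
    GuardsSound ⟨P, Q⟩ last (fun ξ => MvPolynomial.eval ξ p.leadingCoeff ≠ 0)
      (neqGuards P Q p q) := by
  have hH := isRegularSubchain_srsOrdered hq hp
  have hdvd := @map_srsOrdered_dvd _ _ F _ _ q p hq hp
  have hend := @map_eq_zero_of_srsOrdered _ _ F _ _ q p hq hp
  unfold neqGuards
  generalize srsOrdered q p = H at *
  have hpos := hH.length_pos
  simp only [getLastD_eq_getD]
  have hstep : ∀ i < H.length, ∀ ξ β, MvPolynomial.eval ξ p.leadingCoeff ≠ 0 →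
      MvPolynomial.eval ξ (H.getD i 0).leadingCoeff ≠ 0 →
      (∀ k, i < k → k < H.length → MvPolynomial.eval ξ (H.getD k 0).leadingCoeff = 0) →
      (IsZero ξ β ⟨P, Q⟩ ↔
        IsZero ξ β ⟨insert (pquo p (H.getD i 0)) (P.erase p ∪ lcs (H.drop (i + 1))), Q⟩) := by
    intro i hi ξ β hlc hc hk
    obtain ⟨h1, h2⟩ := hdvd (MvPolynomial.eval ξ) hlc hi hc hk
    rw [isZero_insert_eqs, isZero_union_eqs, forall_lcs_drop, isZero_erase_eqs hpP,
      and_iff_right hk]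
    refine and_congr_left fun hz => evalAt_pquo_eq_zero_iff hc h2 fun h0 => ?_
    exact hz.2 q hqQ (evalAt_eq_zero_of_dvd h1 h0)
  have hlast : ∀ ξ β, MvPolynomial.eval ξ p.leadingCoeff ≠ 0 →
      (∀ k < H.length, MvPolynomial.eval ξ (H.getD k 0).leadingCoeff = 0) →
      ¬ IsZero ξ β ⟨P, Q⟩ := by
    intro ξ β hlc hk hz
    refine hz.2 q hqQ ?_
    rw [evalAt_eq_eval_map, (hend (MvPolynomial.eval ξ) hlc hk).2, eval_zero]
  split_ifs with hfree
  · refine ⟨?_, guardsSound_loop H _ _ ?_ ?_⟩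
    · intro ξ β hlc hc
      have hc' : evalAt ξ β (H.getD (H.length - 1) 0) ≠ 0 := by
        rwa [evalAt_of_natDegree_eq_zero' ξ β hfree]
      obtain ⟨h1, h2⟩ := hdvd (MvPolynomial.eval ξ) hlc (i := H.length - 1) (by omega) hc (by omega)
      rw [isZero_insert_eqs, isZero_erase_eqs hpP, isZero_erase_neqs hqQ,
        ← evalAt_pquo_eq_zero_iff hc h2 hc']
      refine and_congr_right fun h0 => and_iff_right fun hq0 => hc' ?_
      exact evalAt_eq_zero_of_mem_span (hH.mem_span _ (by omega)) hq0 h0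
    · rintro i hi ξ β ⟨hlc, hS⟩ hc hk
      refine hstep i (by omega) ξ β hlc hc fun k hik hkl => ?_
      by_cases h1 : k = H.length - 1
      · exact h1 ▸ not_not.mp hS
      · exact hk k hik (by omega)
    · rintro ξ β ⟨hlc, hS⟩ hk hz
      refine absurd hz (hlast ξ β hlc fun k hkl => ?_)
      by_cases h1 : k = H.length - 1
      · exact h1 ▸ not_not.mp hS
      · exact hk k (by omega)
  · exact guardsSound_loop H _ _ hstep fun ξ β hlc hk hz => absurd hz (hlast ξ β hlc hk)

end

/-! ### Decrease of the total degree -/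

section

variable {R : Type*} [CommRing R]

/-- The sum of the degrees in the main variable of all polynomials of a system. -/
noncomputable def degreeSum (A : PolySystem R[X]) : ℕ :=
  ∑ p ∈ A.eqs, p.natDegree + ∑ q ∈ A.neqs, q.natDegree

theorem sum_insert_le {M : Type*} [DecidableEq M] (f : M → ℕ) (a : M) (s : Finset M) :
    ∑ x ∈ insert a s, f x ≤ f a + ∑ x ∈ s, f x := by
  by_cases h : a ∈ s
  · rw [Finset.insert_eq_of_mem h]
    exact Nat.le_add_left _ _
  · rw [Finset.sum_insert h]

theorem sum_union_le {M : Type*} [DecidableEq M] (f : M → ℕ) (s t : Finset M)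
    (ht : ∀ x ∈ t, f x = 0) : ∑ x ∈ s ∪ t, f x ≤ ∑ x ∈ s, f x := by
  have := Finset.sum_union_inter (s₁ := s) (s₂ := t) (f := f)
  rw [Finset.sum_eq_zero ht] at this
  omega

theorem natDegree_of_mem_lcs {H : List R[X]} {l : R[X]} (hl : l ∈ lcs H) : l.natDegree = 0 := by
  simp only [lcs, List.mem_toFinset, List.mem_map] at hl
  obtain ⟨h, -, rfl⟩ := hl
  exact natDegree_C _

open scoped Classical

theorem degreeSum_reductumGuard_lt {P Q : Finset R[X]} {p : R[X]} (hpP : p ∈ P)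
    (hp : 0 < p.natDegree) : degreeSum (reductumGuard P Q p).2 < degreeSum ⟨P, Q⟩ := by
  simp only [degreeSum, reductumGuard]
  have h1 := sum_insert_le natDegree p.eraseLead (P.erase p)
  have h2 := Finset.add_sum_erase P natDegree hpP
  have h3 := eraseLead_natDegree_le p
  omega

theorem degreeSum_neqReductumGuard_lt {P Q : Finset R[X]} {q : R[X]} (hqQ : q ∈ Q)
    (hq : 0 < q.natDegree) : degreeSum (neqReductumGuard P Q q).2 < degreeSum ⟨P, Q⟩ := by
  simp only [degreeSum, neqReductumGuard]
  have h1 := sum_insert_le natDegree q.eraseLead (Q.erase q)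
  have h2 := Finset.add_sum_erase Q natDegree hqQ
  have h3 := eraseLead_natDegree_le q
  omega

theorem degreeSum_eqGuards_lt [IsDomain R] {P Q : Finset R[X]} {p p' : R[X]} (hpP : p ∈ P)
    (hpP' : p' ∈ P) (hne : p' ≠ p) (hp : 0 < p.natDegree) (hle : p.natDegree ≤ p'.natDegree) :
    ∀ x ∈ eqGuards P Q p p', degreeSum x.2 < degreeSum ⟨P, Q⟩ := by
  have hH := isRegularSubchain_srs hp hle
  have h1 := Finset.add_sum_erase P natDegree hpP
  have h2 := Finset.add_sum_erase (P.erase p) natDegree (Finset.mem_erase.mpr ⟨hne, hpP'⟩)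
  have hloop : ∀ m ≤ (srs p' p).length, ∀ x ∈ (List.range m).reverse.map fun i =>
      (PolyConstraint.neZero ((srs p' p).getD i 0).leadingCoeff,
        (⟨insert ((srs p' p).getD i 0)
          ((P.erase p).erase p' ∪ lcs ((srs p' p).drop (i + 1))), Q⟩ : PolySystem R[X])),
      degreeSum x.2 < degreeSum ⟨P, Q⟩ := by
    intro m hm x hx
    obtain ⟨i, hi, rfl⟩ := List.mem_map.mp hx
    have hi' : i < m := List.mem_range.mp (List.mem_reverse.mp hi)
    simp only [degreeSum]
    have h3 := sum_insert_le natDegree ((srs p' p).getD i 0)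
      ((P.erase p).erase p' ∪ lcs ((srs p' p).drop (i + 1)))
    have h4 := sum_union_le natDegree ((P.erase p).erase p') (lcs ((srs p' p).drop (i + 1)))
      fun l hl => natDegree_of_mem_lcs hl
    have h5 := hH.natDegree_le_right i (by omega)
    omega
  unfold eqGuards
  simp only [getLastD_eq_getD]
  split_ifs with hfree
  · intro x hx
    rcases List.mem_cons.mp hx with rfl | hx
    · have hpos := hH.length_pos
      simp only [degreeSum]
      have h3 := sum_insert_le natDegree ((srs p' p).getD ((srs p' p).length - 1) 0)
        (insert ((srs p' p).getD ((srs p' p).length - 2) 0) ((P.erase p).erase p'))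
      have h4 := sum_insert_le natDegree ((srs p' p).getD ((srs p' p).length - 2) 0)
        ((P.erase p).erase p')
      have h5 := hH.natDegree_le_right ((srs p' p).length - 2) (by omega)
      omega
    · exact hloop _ (by omega) x hx
  · exact hloop _ le_rfl

theorem degreeSum_neqGuards_lt [IsDomain R] {P Q : Finset R[X]} {p q : R[X]} (hpP : p ∈ P)
    (hqQ : q ∈ Q) (hp : 0 < p.natDegree) (hq : 0 < q.natDegree) :
    ∀ x ∈ neqGuards P Q p q, degreeSum x.2 < degreeSum ⟨P, Q⟩ := by
  have hH := isRegularSubchain_srsOrdered hq hp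
  have h1 := Finset.add_sum_erase P natDegree hpP
  have h2 := Finset.add_sum_erase Q natDegree hqQ
  unfold neqGuards
  generalize srsOrdered q p = H at *
  have hpos := hH.length_pos
  simp only [getLastD_eq_getD]
  have hloop : ∀ m ≤ H.length, (∀ i < m, 0 < (H.getD i 0).natDegree) →
      ∀ x ∈ (List.range m).reverse.map fun i =>
      (PolyConstraint.neZero (H.getD i 0).leadingCoeff,
        (⟨insert (pquo p (H.getD i 0)) (P.erase p ∪ lcs (H.drop (i + 1))), Q⟩ :
          PolySystem R[X])),
      degreeSum x.2 < degreeSum ⟨P, Q⟩ := by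
    intro m hm hdeg x hx
    obtain ⟨i, hi, rfl⟩ := List.mem_map.mp hx
    have hi' : i < m := List.mem_range.mp (List.mem_reverse.mp hi)
    simp only [degreeSum]
    have h3 := sum_insert_le natDegree (pquo p (H.getD i 0))
      (P.erase p ∪ lcs (H.drop (i + 1)))
    have h4 := sum_union_le natDegree (P.erase p) (lcs (H.drop (i + 1)))
      fun l hl => natDegree_of_mem_lcs hl
    have h5 := natDegree_pquo_le (p := p) (hH.ne_zero i (by omega))
    have h6 := hdeg i hi'
    omega
  split_ifs with hfree
  · intro x hx
    rcases List.mem_cons.mp hx with rfl | hx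
    · simp only [degreeSum]
      have h3 := sum_insert_le natDegree (pquo p (H.getD (H.length - 1) 0)) (P.erase p)
      have h4 := natDegree_pquo_le (p := p) (hH.ne_zero (H.length - 1) (by omega))
      omega
    · refine hloop _ (by omega) (fun i hi => ?_) x hx
      have := hH.natDegree_lt i (H.length - 1) hi (by omega)
      omega
  · refine hloop _ le_rfl fun i hi => ?_
    rcases (Nat.le_sub_one_of_lt hi).lt_or_eq with h | rfl
    · have := hH.natDegree_lt i (H.length - 1) h (by omega)
      omega
    · omega

end

/-! ### The body of the algorithm -/

/-- What one execution of the body on `A` achieves: the contributed systems exclude `α`, the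
recursive calls inherit that there is no zero above `α` and either return at once or have a smaller
total degree, and together they cover the zeros of `A`. -/
structure BodySpec (α : Fin n → F) (A : PolySystem (MvPolynomial (Fin n) F)[X])
    (Δ : Finset (PolySystem (MvPolynomial (Fin n) F)))
    (Bs : Finset (PolySystem (MvPolynomial (Fin n) F)[X])) : Prop where
  notMem : ∀ D ∈ Δ, α ∉ zeroq D
  not_isZero : ∀ B ∈ Bs, ∀ β, ¬ IsZero α β B
  decrease : ∀ B ∈ Bs, (∃ u, ExcludesNeq α B u) ∨ degreeSum B < degreeSum A
  cover : ∀ ξ β, IsZero ξ β A → (∃ D ∈ Δ, ξ ∈ zeroq D) ∨ ∃ B ∈ Bs, IsZero ξ β B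

theorem bodySpec_runGuards {α : Fin n → F} {A : PolySystem (MvPolynomial (Fin n) F)[X]}
    (hA : ∀ β, ¬ IsZero α β A) {last : Finset (PolySystem (MvPolynomial (Fin n) F)[X])}
    {G : List (PolyConstraint (MvPolynomial (Fin n) F) × PolySystem (MvPolynomial (Fin n) F)[X])}
    {Δ : Finset (PolySystem (MvPolynomial (Fin n) F))}
    {Bs : Finset (PolySystem (MvPolynomial (Fin n) F)[X])} (hE : runGuards α last G = (Δ, Bs))
    (hlast : ∀ B ∈ last, ∃ u, ExcludesNeq α B u)
    (hdeg : ∀ x ∈ G, degreeSum x.2 < degreeSum A)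
    (hG : GuardsSound A last (fun _ => True) G) : BodySpec α A Δ Bs := by
  obtain rfl : _ = Δ := congrArg Prod.fst hE
  obtain rfl : _ = Bs := congrArg Prod.snd hE
  exact
    { notMem := notMem_zeroq_runGuards α last G
      not_isZero := hG.not_isZero hA
        (fun B hB β => (hlast B hB).elim fun _ h => h.not_isZero β) trivial
      decrease := fun B hB =>
        (mem_runGuards_snd hB).imp (hlast B) fun ⟨x, hx, h⟩ => h ▸ hdeg x hx
      cover := fun _ _ hz => hG.cover trivial hz }

theorem GuardsSound.mono {A : PolySystem (MvPolynomial (Fin n) F)[X]}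
    {last : Finset (PolySystem (MvPolynomial (Fin n) F)[X])}
    {G : List (PolyConstraint (MvPolynomial (Fin n) F) × PolySystem (MvPolynomial (Fin n) F)[X])}
    {S T : (Fin n → F) → Prop} (hST : ∀ ξ, T ξ → S ξ) (hG : GuardsSound A last S G) :
    GuardsSound A last T G := by
  induction G generalizing S T with
  | nil => exact fun ξ β hT => hG ξ β (hST ξ hT)
  | cons cB G ih =>
    exact ⟨fun ξ β hT => hG.1 ξ β (hST ξ hT), ih (fun ξ h => ⟨hST ξ h.1, h.2⟩) hG.2⟩

theorem guardsSound_reductumGuard_cons {A : PolySystem (MvPolynomial (Fin n) F)[X]}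
    {last : Finset (PolySystem (MvPolynomial (Fin n) F)[X])}
    {G : List (PolyConstraint (MvPolynomial (Fin n) F) × PolySystem (MvPolynomial (Fin n) F)[X])}
    {p : (MvPolynomial (Fin n) F)[X]} (hp : p ∈ A.eqs)
    (hG : GuardsSound A last (fun ξ => MvPolynomial.eval ξ p.leadingCoeff ≠ 0) G) :
    GuardsSound A last (fun _ => True) (reductumGuard A.eqs A.neqs p :: G) :=
  ⟨fun _ β _ hc => isZero_reductumGuard hp β hc, hG.mono fun _ h => h.2⟩

/-- For the guarded calls this is their soundness. For the concluding calls without a second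
polynomial, a zero above `ξ` would also be a zero above `α` if the coefficients over `ξ` and over `α`
agreed. -/
theorem Body.spec {α : Fin n → F} {A : PolySystem (MvPolynomial (Fin n) F)[X]}
    (hA : ∀ β, ¬ IsZero α β A) {Δ : Finset (PolySystem (MvPolynomial (Fin n) F))}
    {Bs : Finset (PolySystem (MvPolynomial (Fin n) F)[X])} (h : Body α A Δ Bs) :
    BodySpec α A Δ Bs := by
  classical
  cases h with
  | returnEq p hp =>
    refine ⟨?_, by simp, by simp, fun ξ β hz => Or.inl ⟨_, Finset.mem_singleton_self _, ?_⟩⟩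
    · simpa [zeroq] using hp.2.2
    · simpa [zeroq, evalAt_of_natDegree_eq_zero ξ β hp.2.1] using hz.1 p hp.1
  | returnNeq q hP hq =>
    refine ⟨?_, by simp, by simp, fun ξ β hz => Or.inl ⟨_, Finset.mem_singleton_self _, ?_⟩⟩
    · simpa [zeroq] using hq.2.2
    · simpa [zeroq, evalAt_of_natDegree_eq_zero ξ β hq.2.1] using hz.2 q hq.1
  | twoEqs p p' hp hp' Δ Bs hE =>
    obtain ⟨hpP, hpd⟩ := mem_hat.mp hp.2.2.1
    obtain ⟨hne, hp'⟩ := Finset.mem_erase.mp hp'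
    have hle := hp.2.2.2 p' hp'
    have hpP' := (mem_hat.mp hp').1
    refine bodySpec_runGuards hA hE (fun B => excludesNeq_of_mem_projCoeffCalls) ?_
      (guardsSound_reductumGuard_cons hpP (guardsSound_eqGuards hpP hpP' hne hpd hle))
    exact List.forall_mem_cons.mpr ⟨degreeSum_reductumGuard_lt hpP hpd,
      degreeSum_eqGuards_lt hpP hpP' hne hpd hle⟩
  | eqNeq p q hp hP hq Δ Bs hE =>
    obtain ⟨hpP, hpd⟩ := mem_hat.mp hp.2.2.1
    obtain ⟨hqQ, hqd⟩ := mem_hat.mp hq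
    refine bodySpec_runGuards hA hE (fun B => excludesNeq_of_mem_projCoeffCalls) ?_
      (guardsSound_reductumGuard_cons hpP (guardsSound_neqGuards hpP hqQ hpd hqd))
    exact List.forall_mem_cons.mpr ⟨degreeSum_reductumGuard_lt hpP hpd,
      degreeSum_neqGuards_lt hpP hqQ hpd hqd⟩
  | oneEq p hp hP hQ Δ Bs hE =>
    obtain ⟨hpP, hpd⟩ := mem_hat.mp hp.2.2.1
    refine bodySpec_runGuards hA hE (fun B => excludesNeq_of_mem_projCoeffCalls) ?_
      (guardsSound_reductumGuard_cons hpP fun ξ β _ hz => exists_mem_projCoeffCalls hz fun h => ?_)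
    · exact List.forall_mem_cons.mpr ⟨degreeSum_reductumGuard_lt hpP hpd, by simp⟩
    · -- otherwise the root `β` of `p` over `ξ` is also a root over `α`
      refine hA β (isZero_of_hat hp.1 hp.2.1 ?_ (by simp [hQ]))
      simpa [hP, h] using hz.1 p hpP
  | neqs L hU hN hP hQ hL hLQ Δ Bs hE =>
    have hmem : ∀ q ∈ L, q ∈ A.neqs ∧ 0 < q.natDegree := fun q hq => by
      rw [← mem_hat, ← hLQ]
      exact List.mem_toFinset.mpr hq
    refine bodySpec_runGuards hA hE (fun B => excludesNeq_of_mem_projCoeffCalls) ?_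
      (guardsSound_of_forall ?_ fun ξ β hz => exists_mem_projCoeffCalls
        ⟨hz.1, fun q hq => hz.2 q (Finset.mem_sdiff.mp hq).1⟩ fun h => ?_)
    · rintro x hx
      obtain ⟨q, hq, rfl⟩ := List.mem_map.mp hx
      exact degreeSum_neqReductumGuard_lt (hmem q hq).1 (hmem q hq).2
    · rintro x hx ξ β hc
      obtain ⟨q, hq, rfl⟩ := List.mem_map.mp hx
      exact isZero_neqReductumGuard (hmem q hq).1 β hc
    · refine hA β (isZero_of_hat hU hN (by simp [hP]) ?_)
      have hne : evalAt ξ β (∏ q ∈ hat A.neqs, q) ≠ 0 := by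
        rw [map_prod, Finset.prod_ne_zero_iff]
        exact fun q hq => hz.2 q (mem_hat.mp hq).1
      rwa [← h, map_prod, Finset.prod_ne_zero_iff] at hne

theorem Body.exists {α : Fin n → F} {A : PolySystem (MvPolynomial (Fin n) F)[X]}
    (hA : ∀ β, ¬ IsZero α β A) : ∃ Δ Bs, Body α A Δ Bs := by
  classical
  by_cases hU : ∃ u, ExcludesEq α A u
  · exact ⟨_, _, Body.returnEq _ hU.choose_spec⟩
  push Not at hU
  by_cases hN : ∃ u, ExcludesNeq α A u
  · exact ⟨_, _, Body.returnNeq _ hU hN.choose_spec⟩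
  push Not at hN
  rcases (hat A.eqs).eq_empty_or_nonempty with hP | hP
  · have hQ : (hat A.neqs).Nonempty := by
      by_contra hQ
      rw [Finset.not_nonempty_iff_eq_empty] at hQ
      exact hA 0 (isZero_of_hat hU hN (by simp [hP]) (by simp [hQ]))
    exact ⟨_, _, Body.neqs (hat A.neqs).toList hU hN hP hQ (Finset.nodup_toList _)
      (by ext; simp) _ _ rfl⟩
  · obtain ⟨p, hp, hmin⟩ := Finset.exists_min_image _ natDegree hP
    have hsel : SelectsEq α A p := ⟨hU, hN, hp, hmin⟩
    by_cases h1 : hat A.eqs = {p}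
    · rcases (hat A.neqs).eq_empty_or_nonempty with hQ | ⟨q, hq⟩
      · exact ⟨_, _, Body.oneEq p hsel h1 hQ _ _ rfl⟩
      · exact ⟨_, _, Body.eqNeq p q hsel h1 hq _ _ rfl⟩
    · obtain ⟨p', hp', hne⟩ : ∃ p' ∈ hat A.eqs, p' ≠ p := by
        by_contra! hc
        exact h1 (Finset.eq_singleton_iff_unique_mem.mpr ⟨hp, hc⟩)
      exact ⟨_, _, Body.twoEqs p p' hsel (by simp [hne, hp']) _ _ rfl⟩

/-! ### Termination and correctness -/

theorem Body.eq_empty_of_excludesNeq {α : Fin n → F}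
    {A : PolySystem (MvPolynomial (Fin n) F)[X]} {u : (MvPolynomial (Fin n) F)[X]}
    (hu : ExcludesNeq α A u) {Δ : Finset (PolySystem (MvPolynomial (Fin n) F))}
    {Bs : Finset (PolySystem (MvPolynomial (Fin n) F)[X])} (h : Body α A Δ Bs) : Bs = ∅ := by
  cases h with
  | returnEq | returnNeq => rfl
  | twoEqs _ _ hp | eqNeq _ _ hp | oneEq _ hp => exact absurd hu (hp.2.1 u)
  | neqs _ _ hN => exact absurd hu (hN u)

theorem terminates_of_not_isZero {α : Fin n → F} (A : PolySystem (MvPolynomial (Fin n) F)[X])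
    (hA : ∀ β, ¬ IsZero α β A) : Terminates α A := by
  induction hd : degreeSum A using Nat.strong_induction_on generalizing A with
  | _ d ih =>
    refine ⟨A, Body.exists hA, fun Δ Bs h B hB => ?_⟩
    have hs := h.spec hA
    rcases hs.decrease B hB with ⟨u, hu⟩ | hlt
    · refine ⟨B, Body.exists (hs.not_isZero B hB), fun Δ' Bs' h' B' hB' => ?_⟩
      simp [h'.eq_empty_of_excludesNeq hu] at hB'
    · exact ih _ (hd ▸ hlt) B (hs.not_isZero B hB) rfl

theorem Terminates.exists_returns {α : Fin n → F} {A : PolySystem (MvPolynomial (Fin n) F)[X]}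
    (h : Terminates α A) : ∃ Δ, Returns α A Δ := by
  classical
  induction h with
  | intro A hA _ ih =>
    obtain ⟨Δ, Bs, hB⟩ := hA
    choose R hR using ih Δ Bs hB
    exact ⟨_, Returns.intro A Δ Bs (fun B => if h : B ∈ Bs then R B h else ∅) hB
      fun B h => by simpa [h] using hR B h⟩

theorem Returns.isWeakProjecting {α : Fin n → F} {A : PolySystem (MvPolynomial (Fin n) F)[X]}
    {Δ : Finset (PolySystem (MvPolynomial (Fin n) F))} (h : Returns α A Δ)
    (hA : ∀ β, ¬ IsZero α β A) :
    (∀ ξ β, IsZero ξ β A → ∃ D ∈ Δ, ξ ∈ zeroq D) ∧ ∀ D ∈ Δ, α ∉ zeroq D := by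
  classical
  induction h with
  | intro A Δ Bs R hB _ ih =>
    have hs := hB.spec hA
    constructor
    · intro ξ β hz
      rcases hs.cover ξ β hz with ⟨D, hD, hξ⟩ | ⟨B, hBs, hB⟩
      · exact ⟨D, Finset.mem_union_left _ hD, hξ⟩
      · obtain ⟨D, hD, hξ⟩ := (ih B hBs (hs.not_isZero B hBs)).1 ξ β hB
        exact ⟨D, Finset.mem_union_right _ (Finset.mem_biUnion.mpr ⟨B, hBs, hD⟩), hξ⟩
    · intro D hD
      rcases Finset.mem_union.mp hD with hD | hD
      · exact hs.notMem D hD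
      · obtain ⟨B, hBs, hD⟩ := Finset.mem_biUnion.mp hD
        exact (ih B hBs (hs.not_isZero B hBs)).2 D hD

/-! ### Passage to the last variable -/

theorem evalAt_toUnivariate (ξ : Fin n → F) (β : F) (p : MvPolynomial (Fin (n + 1)) F) :
    evalAt ξ β (toUnivariate p) = MvPolynomial.eval (Fin.snoc ξ β : Fin (n + 1) → F) p := by
  induction p using MvPolynomial.induction_on with
  | C a =>
    simp only [toUnivariate, MvPolynomial.aeval_C, MvPolynomial.eval_C]
    rw [IsScalarTower.algebraMap_apply F (MvPolynomial (Fin n) F), algebraMap_eq, evalAt_C,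
      MvPolynomial.algebraMap_eq, MvPolynomial.eval_C]
  | add p q hp hq => rw [map_add, map_add, map_add, hp, hq]
  | mul_X p i hp =>
    rw [map_mul, map_mul, map_mul, hp]
    congr 1
    refine Fin.lastCases ?_ (fun j => ?_) i
    · simp [toUnivariate, evalAt]
    · simp [toUnivariate]

theorem isZero_toUnivariate (ξ : Fin n → F) (β : F)
    (A : PolySystem (MvPolynomial (Fin (n + 1)) F)) :
    IsZero ξ β A.toUnivariate ↔ (Fin.snoc ξ β : Fin (n + 1) → F) ∈ zeroq A := by
  simp [IsZero, PolySystem.toUnivariate, zeroq, evalAt_toUnivariate]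

end PReg

theorem mainTheorem1 {F : Type*} [Field F] [Finite F] {n : ℕ}
    (A : PolySystem (MvPolynomial (Fin (n + 1)) F)) (α : Fin n → F)
    (hα : ¬ ∃ β : F, (Fin.snoc α β : Fin (n + 1) → F) ∈ zeroq A) :
    PReg.Terminates α A.toUnivariate ∧
      (∃ Δ, PReg.Returns α A.toUnivariate Δ) ∧
      ∀ Δ, PReg.Returns α A.toUnivariate Δ → IsWeakProjectingZeroDecomposition A α Δ := by
  have hA : ∀ β, ¬ PReg.IsZero α β A.toUnivariate := fun β h =>
    hα ⟨β, (PReg.isZero_toUnivariate α β A).mp h⟩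
  have hT := PReg.terminates_of_not_isZero _ hA
  refine ⟨hT, hT.exists_returns, fun Δ hΔ => ?_⟩
  obtain ⟨h1, h2⟩ := hΔ.isWeakProjecting hA
  refine ⟨?_, h2⟩
  rintro ξ ⟨β, hβ⟩
  simpa using h1 ξ β ((PReg.isZero_toUnivariate ξ β A).mpr hβ)
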